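/- **Setting.** Let $n,p\ge 1$, $m,T\ge 0$ be integers and consider $x_{t+1}=A_tx_t+B_tu_t+v_t$, $y_t=C_tx_t+w_t$ for $t=0,\dots,T-1$, with $x_t,v_t\in\mathbb R^n$, $u_t\in\mathbb R^m$, $y_t,w_t\in\mathbb R^p$ and a deterministic initial state $x_0=\mathrm x$. Let $Q_t\succeq0$ ($0\le t\le T$) and $R_t\succ0$ ($0\le t\le T-1$) be symmetric. Fix a linear (affine) causal output-feedback policy $u_t=\sum_{s\le t}K_{t,s}y_s+k_t$. For probability distributions $\mu$ on $\mathbb R^n$ and $\nu$ on $\mathbb R^p$ let $$\mathcal J(\mu,\nu)=\mathbb E\Big[x_T^\top Q_Tx_T+\sum_{t=0}^{T-1}\big(x_t^\top Q_tx_t+u_t^\top R_tu_t\big)\Big]$$ be the closed-loop cost when $v_0,\dots,v_{T-1}\sim\mu$ and $w_0,\dots,w_{T-1}\sim\nu$ are all independent. **Matrices.** Let $A_s^t=A_{t-1}\cdots A_s$ for $s<t$ and $A_s^t=I_n$ otherwise; $Q=\mathrm{diag}(Q_0,\dots,Q_T)$, $R=\mathrm{diag}(R_0,\dots,R_{T-1})$;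 $C$ is the block matrix with $T\times(T+1)$ blocks, $C_t$ in position $(t,t)$ and $0$ elsewhere; $G$ and $H$ have $(T+1)\times T$ blocks, the block in position $(t,s)$, $0\le t\le T$, $0\le s\le T-1$, being $A_{s+1}^t$, respectively $A_{s+1}^tB_s$, if $s<t$, and $0$ otherwise; $L$ has blocks $A_0^t$, $0\le t\le T$; and $D=CG$. Let $K$ be the block lower triangular matrix $(K_{t,s})$, $k=(k_t)_t$, and $$U=(I-KCH)^{-1}K,\qquad q=(I-KCH)^{-1}(k+KCL\mathrm x),$$ so that along the closed loop $u=U(Dv+w)+q$ for the stacked inputs and noises. Put $$F_1=D^\top U^\top RUD+(HUD+G)^\top Q(HUD+G),\qquad F_2=U^\top RU+U^\top H^\top QHU,$$ $$F_3=2U^\top RUD+2U^\top H^\top Q(HUD+G),$$ $$f_1^\top=2q^\top(RUD+H^\top QG+H^\top QHUD)+2\mathrm x^\top L^\top Q(HUD+G),$$ $$f_2^\top=2q^\top(R+H^\top QH)U+2\mathrm x^\top L^\top QHU,$$ and, with block indices $t,t'$ running over the $T$ time steps, $$P_v=\sum_tF_{1,tt},\quad P_w=\sum_tF_{2,tt},\quad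 N_v=\sum_{t<t'}(F_{1,tt'}+F_{1,tt'}^\top),\quad N_w=\sum_{t<t'}(F_{2,tt'}+F_{2,tt'}^\top),$$ $$S=\sum_{t,t'}F_{3,tt'},\quad n_v=\sum_tf_{1,t},\quad n_w=\sum_tf_{2,t},\quad c_0=q^\top Rq+(Hq+L\mathrm x)^\top Q(Hq+L\mathrm x).$$ **Statement.** Let $\hat\mu$ on $\mathbb R^n$ and $\hat\nu$ on $\mathbb R^p$ be (possibly non-Gaussian) probability distributions with zero means and covariance matrices $\hat V\succ0$, $\hat W\succ0$, let $\rho_v,\rho_w>0$, and let $\mathcal A=\{\mu: W_2(\mu,\hat\mu)\le\rho_v\}$ and $\mathcal B=\{\nu: W_2(\nu,\hat\nu)\le\rho_w\}$ be the balls in the Wasserstein distance of order two. The cost is integrable, hence $\mathcal J(\mu,\nu)$ is finite, for all $\mu\in\mathcal A$, $\nu\in\mathcal B$, and there are $\lambda_v,\lambda_w\in\mathbb R$, $m_v\in\mathbb R^n$, $m_w\in\mathbb R^p$ such that the following hold. 1. $\lambda_v>\lambda_{\max}(P_v)$ if $P_v\ne0$, and $\lambda_v=0$ if $P_v=0$;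 likewise $\lambda_w>\lambda_{\max}(P_w)$ if $P_w\neq0$, and $\lambda_w=0$ if $P_w=0$. (In the degenerate case $P_v=0$, $\lambda_v=0$, read $P_v/\lambda_v$ as $0$ and all traces below that contain $P_v$ as $0$; likewise for $w$.) 2. $\operatorname{tr}\big(\hat VP_v^2(\lambda_vI_n-P_v)^{-2}\big)+\|m_v\|^2=\rho_v^2$ and $\operatorname{tr}\big(\hat WP_w^2(\lambda_wI_p-P_w)^{-2}\big)+\|m_w\|^2=\rho_w^2$. 3. $$\begin{bmatrix}\lambda_vI_n-P_v-N_v&-\frac12S^\top\\-\frac12S&\lambda_wI_p-P_w-N_w\end{bmatrix}\begin{bmatrix}m_v\\m_w\end{bmatrix}=\frac12\begin{bmatrix}n_v\\n_w\end{bmatrix}.$$ 4. With $f_v(\hat v)=(I_n-P_v/\lambda_v)^{-1}\hat v+m_v$ and $f_w(\hat w)=(I_p-P_w/\lambda_w)^{-1}\hat w+m_w$, the pushforwards $\mu^*=(f_v)_\#\hat\mu$ and $\nu^*=(f_w)_\#\hat\nu$ lie in $\mathcal A$ and $\mathcal B$, and $\mathcal J(\mu^*,\nu^*)=\max_{\mu\in\mathcal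 A,\,\nu\in\mathcal B}\mathcal J(\mu,\nu)$; in particular the supremum is attained. 5. The worst-case cost is $$\mathcal J(\mu^*,\nu^*)=c_0+\lambda_v\rho_v^2+\lambda_v\operatorname{tr}\big(\hat VP_v(\lambda_vI_n-P_v)^{-1}\big)+\tfrac12m_v^\top n_v+\lambda_w\rho_w^2+\lambda_w\operatorname{tr}\big(\hat WP_w(\lambda_wI_p-P_w)^{-1}\big)+\tfrac12m_w^\top n_w.$$ 6. $\mu^*$ and $\nu^*$ have means $m_v,m_w$ and covariance matrices $(I_n-P_v/\lambda_v)^{-1}\hat V(I_n-P_v/\lambda_v)^{-1}$ and $(I_p-P_w/\lambda_w)^{-1}\hat W(I_p-P_w/\lambda_w)^{-1}$. 7. If $\hat\mu$ is Gaussian, so is $\mu^*$; if $\hat\nu$ is Gaussian, so is $\nu^*$. -/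

import Mathlib

open MeasureTheory ProbabilityTheory Matrix
open scoped ENNReal

/-! ### Wasserstein ambiguity sets -/

/-- The couplings of two probability distributions. -/
def couplings {E : Type*} [MeasurableSpace E] (μ ν : Measure E) : Set (Measure (E × E)) :=
  {γ | IsProbabilityMeasure γ ∧ γ.map Prod.fst = μ ∧ γ.map Prod.snd = ν}

/-- The Wasserstein distance of order two, with values in `[0, ∞]`. -/
noncomputable def wasserstein2 {E : Type*} [NormedAddCommGroup E] [MeasurableSpace E]
    (μ ν : Measure E) : ℝ≥0∞ :=
  (⨅ γ ∈ couplings μ ν, ∫⁻ z, ‖z.1 - z.2‖ₑ ^ 2 ∂γ) ^ (1 / 2 : ℝ)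

/-- The Wasserstein ball of radius `r` around the reference distribution `μref`. -/
def ambiguitySet {E : Type*} [NormedAddCommGroup E] [MeasurableSpace E]
    (r : ℝ) (μref : Measure E) : Set (Measure E) :=
  {μ | IsProbabilityMeasure μ ∧ wasserstein2 μ μref ≤ ENNReal.ofReal r}

/-- `μ` has finite second moments, mean `mean` and covariance matrix `V`. -/
structure HasMeanCov {d : ℕ} (μ : Measure (EuclideanSpace ℝ (Fin d)))
    (mean : EuclideanSpace ℝ (Fin d)) (V : Matrix (Fin d) (Fin d) ℝ) : Prop where
  memLp : MemLp id 2 μ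
  mean_eq : ∫ x, x ∂μ = mean
  cov_eq : ∀ i j, ∫ x, (x i - mean i) * (x j - mean j) ∂μ = V i j

/-! ### The linear-quadratic control problem -/

/-- The data of a time-varying linear system with state dimension `n`, input dimension `m`, output
dimension `p` and horizon `T`, together with the cost matrices. -/
structure LQSystem (n m p T : ℕ) where
  A : Fin T → Matrix (Fin n) (Fin n) ℝ
  B : Fin T → Matrix (Fin n) (Fin m) ℝ
  C : Fin T → Matrix (Fin p) (Fin n) ℝ
  Q : Fin (T + 1) → Matrix (Fin n) (Fin n) ℝ
  R : Fin T → Matrix (Fin m) (Fin m) ℝ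

/-- A causal output-feedback policy: `π t` maps the outputs `y_0, …, y_t` to the input `u_t`. -/
abbrev Policy (m p T : ℕ) : Type :=
  (t : Fin T) → (Fin (t.val + 1) → Fin p → ℝ) → Fin m → ℝ

/-- The parameters of a linear (affine) policy `u_t = ∑_{s ≤ t} K_{t,s} y_s + k_t`. -/
structure LinearPolicy (m p T : ℕ) where
  K : (t : Fin T) → Fin (t.val + 1) → Matrix (Fin m) (Fin p) ℝ
  k : Fin T → Fin m → ℝ

/-- The policy given by the parameters of a linear policy. -/
def LinearPolicy.toPolicy {m p T : ℕ} (π : LinearPolicy m p T) : Policy m p T :=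
  fun t y => ∑ s, π.K t s *ᵥ y s + π.k t

namespace LQSystem

variable {n m p T : ℕ} (S : LQSystem n m p T)

/-- The closed-loop state `x_t`: `x_{t+1} = A_t x_t + B_t u_t + v_t` with `u_t = π_t(y_0, …, y_t)`
and `y_s = C_s x_s + w_s`. -/
noncomputable def state (x₀ : Fin n → ℝ) (π : Policy m p T)
    (v : Fin T → EuclideanSpace ℝ (Fin n)) (w : Fin T → EuclideanSpace ℝ (Fin p)) :
    (t : ℕ) → t ≤ T → Fin n → ℝ
  | 0, _ => x₀
  | t + 1, h =>
      S.A ⟨t, h⟩ *ᵥ state x₀ π v w t (Nat.le_of_succ_le h)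
        + S.B ⟨t, h⟩ *ᵥ π ⟨t, h⟩ (fun s : Fin (t + 1) =>
            S.C ⟨s.val, lt_of_lt_of_le s.isLt h⟩ *ᵥ
                state x₀ π v w s.val ((Nat.le_of_lt s.isLt).trans h)
              + (w ⟨s.val, lt_of_lt_of_le s.isLt h⟩).ofLp)
        + (v ⟨t, h⟩).ofLp
termination_by t => t
decreasing_by all_goals omega

/-- The closed-loop output `y_t = C_t x_t + w_t`. -/
noncomputable def output (x₀ : Fin n → ℝ) (π : Policy m p T)
    (v : Fin T → EuclideanSpace ℝ (Fin n)) (w : Fin T → EuclideanSpace ℝ (Fin p))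
    (t : Fin T) : Fin p → ℝ :=
  S.C t *ᵥ S.state x₀ π v w t.val t.isLt.le + (w t).ofLp

/-- The closed-loop input `u_t = π_t(y_0, …, y_t)`. -/
noncomputable def input (x₀ : Fin n → ℝ) (π : Policy m p T)
    (v : Fin T → EuclideanSpace ℝ (Fin n)) (w : Fin T → EuclideanSpace ℝ (Fin p))
    (t : Fin T) : Fin m → ℝ :=
  π t (fun s => S.output x₀ π v w ⟨s.val, lt_of_lt_of_le s.isLt t.isLt⟩)

/-- The quadratic cost along one closed-loop trajectory. -/
noncomputable def trajectoryCost (x₀ : Fin n → ℝ) (π : Policy m p T)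
    (v : Fin T → EuclideanSpace ℝ (Fin n)) (w : Fin T → EuclideanSpace ℝ (Fin p)) : ℝ :=
  ∑ t : Fin (T + 1),
      S.state x₀ π v w t.val (Nat.le_of_lt_succ t.isLt) ⬝ᵥ
        (S.Q t *ᵥ S.state x₀ π v w t.val (Nat.le_of_lt_succ t.isLt))
    + ∑ t : Fin T, S.input x₀ π v w t ⬝ᵥ (S.R t *ᵥ S.input x₀ π v w t)

/-- The joint distribution of the noise trajectories: all process noises have law `μ`, all
measurement noises have law `ν`, and they are independent. -/
noncomputable def noiseLaw (T : ℕ) {n p : ℕ} (μ : Measure (EuclideanSpace ℝ (Fin n)))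
    (ν : Measure (EuclideanSpace ℝ (Fin p))) :
    Measure ((Fin T → EuclideanSpace ℝ (Fin n)) × (Fin T → EuclideanSpace ℝ (Fin p))) :=
  (Measure.pi fun _ : Fin T => μ).prod (Measure.pi fun _ : Fin T => ν)

/-- The expected cost of a policy against the stationary independent noises with laws `μ`, `ν`. -/
noncomputable def cost (x₀ : Fin n → ℝ) (π : Policy m p T)
    (μ : Measure (EuclideanSpace ℝ (Fin n))) (ν : Measure (EuclideanSpace ℝ (Fin p))) : ℝ :=
  ∫ z, S.trajectoryCost x₀ π z.1 z.2 ∂(noiseLaw T μ ν)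

/-! ### Stacked system matrices -/

/-- The transition matrix `A_{t-1} ⋯ A_s` if `s < t`, and the identity otherwise. -/
def transition (s : ℕ) : (t : ℕ) → t ≤ T → Matrix (Fin n) (Fin n) ℝ
  | 0, _ => 1
  | t + 1, h => if s ≤ t then S.A ⟨t, h⟩ * transition s t (Nat.le_of_succ_le h) else 1

def stackedQ : Matrix (Fin (T + 1) × Fin n) (Fin (T + 1) × Fin n) ℝ :=
  Matrix.of fun a b => if a.1 = b.1 then S.Q a.1 a.2 b.2 else 0

def stackedR : Matrix (Fin T × Fin m) (Fin T × Fin m) ℝ :=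
  Matrix.of fun a b => if a.1 = b.1 then S.R a.1 a.2 b.2 else 0

def stackedC : Matrix (Fin T × Fin p) (Fin (T + 1) × Fin n) ℝ :=
  Matrix.of fun a b => if b.1 = a.1.castSucc then S.C a.1 a.2 b.2 else 0

def stackedG : Matrix (Fin (T + 1) × Fin n) (Fin T × Fin n) ℝ :=
  Matrix.of fun a b => if b.1.val < a.1.val then
    S.transition (b.1.val + 1) a.1.val (Nat.le_of_lt_succ a.1.isLt) a.2 b.2 else 0

def stackedH : Matrix (Fin (T + 1) × Fin n) (Fin T × Fin m) ℝ :=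
  Matrix.of fun a b => if b.1.val < a.1.val then
    (S.transition (b.1.val + 1) a.1.val (Nat.le_of_lt_succ a.1.isLt) * S.B b.1) a.2 b.2 else 0

def stackedL : Matrix (Fin (T + 1) × Fin n) (Fin n) ℝ :=
  Matrix.of fun a j => S.transition 0 a.1.val (Nat.le_of_lt_succ a.1.isLt) a.2 j

/-- `D = C G`: the purified outputs are `η = D v + w`. -/
def stackedD : Matrix (Fin T × Fin p) (Fin T × Fin n) ℝ := S.stackedC * S.stackedG

end LQSystem

/-- The block lower triangular matrix of a linear policy, so that `u = K y + k`. -/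
def LinearPolicy.stackedK {m p T : ℕ} (π : LinearPolicy m p T) :
    Matrix (Fin T × Fin m) (Fin T × Fin p) ℝ :=
  Matrix.of fun a b => if h : b.1.val < a.1.val + 1 then π.K a.1 ⟨b.1.val, h⟩ a.2 b.2 else 0

def LinearPolicy.stackedk {m p T : ℕ} (π : LinearPolicy m p T) : Fin T × Fin m → ℝ :=
  fun a => π.k a.1 a.2

namespace LQSystem

variable {n m p T : ℕ} (S : LQSystem n m p T) (π : LinearPolicy m p T) (x₀ : Fin n → ℝ)

/-- The gain of the linear policy in purified-output form, `u = U η + q`. Substituting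
`y = C H u + η + C L x₀` into `u = K y + k` gives `(I - K C H) u = K η + K C L x₀ + k`, where
`K C H` is strictly block lower triangular. -/
noncomputable def U : Matrix (Fin T × Fin m) (Fin T × Fin p) ℝ :=
  (1 - π.stackedK * S.stackedC * S.stackedH)⁻¹ * π.stackedK

/-- The offset of the linear policy in purified-output form, `u = U η + q`. -/
noncomputable def q : Fin T × Fin m → ℝ :=
  (1 - π.stackedK * S.stackedC * S.stackedH)⁻¹ *ᵥ
    (π.stackedk + π.stackedK *ᵥ (S.stackedC *ᵥ (S.stackedL *ᵥ x₀)))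

noncomputable def F₁ : Matrix (Fin T × Fin n) (Fin T × Fin n) ℝ :=
  S.stackedDᵀ * (S.U π)ᵀ * S.stackedR * S.U π * S.stackedD
    + (S.stackedH * S.U π * S.stackedD + S.stackedG)ᵀ * S.stackedQ *
      (S.stackedH * S.U π * S.stackedD + S.stackedG)

noncomputable def F₂ : Matrix (Fin T × Fin p) (Fin T × Fin p) ℝ :=
  (S.U π)ᵀ * S.stackedR * S.U π
    + (S.U π)ᵀ * S.stackedHᵀ * S.stackedQ * S.stackedH * S.U π

noncomputable def F₃ : Matrix (Fin T × Fin p) (Fin T × Fin n) ℝ :=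
  (2 : ℝ) • ((S.U π)ᵀ * S.stackedR * S.U π * S.stackedD)
    + (2 : ℝ) • ((S.U π)ᵀ * S.stackedHᵀ * S.stackedQ *
      (S.stackedH * S.U π * S.stackedD + S.stackedG))

noncomputable def f₁ : Fin T × Fin n → ℝ :=
  (2 : ℝ) • (S.q π x₀ ᵥ* (S.stackedR * S.U π * S.stackedD + S.stackedHᵀ * S.stackedQ * S.stackedG
      + S.stackedHᵀ * S.stackedQ * S.stackedH * S.U π * S.stackedD))
    + (2 : ℝ) • (x₀ ᵥ* (S.stackedLᵀ * S.stackedQ *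
      (S.stackedH * S.U π * S.stackedD + S.stackedG)))

noncomputable def f₂ : Fin T × Fin p → ℝ :=
  (2 : ℝ) • (S.q π x₀ ᵥ* ((S.stackedR + S.stackedHᵀ * S.stackedQ * S.stackedH) * S.U π))
    + (2 : ℝ) • (x₀ ᵥ* (S.stackedLᵀ * S.stackedQ * S.stackedH * S.U π))

/-- The block of a stacked matrix at block position `(t, t')`. -/
def block {a b T : ℕ} (F : Matrix (Fin T × Fin a) (Fin T × Fin b) ℝ) (t t' : Fin T) :
    Matrix (Fin a) (Fin b) ℝ :=
  F.submatrix (fun i => (t, i)) (fun j => (t', j))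

noncomputable def Pv : Matrix (Fin n) (Fin n) ℝ := ∑ t, block (S.F₁ π) t t

noncomputable def Pw : Matrix (Fin p) (Fin p) ℝ := ∑ t, block (S.F₂ π) t t

/-- The symmetric matrix of the quadratic form `x ↦ 2 ∑_{t < t'} xᵀ F_{1,tt'} x`. -/
noncomputable def Nv : Matrix (Fin n) (Fin n) ℝ :=
  ∑ t, ∑ t' with t < t', (block (S.F₁ π) t t' + (block (S.F₁ π) t t')ᵀ)

/-- The symmetric matrix of the quadratic form `x ↦ 2 ∑_{t < t'} xᵀ F_{2,tt'} x`. -/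
noncomputable def Nw : Matrix (Fin p) (Fin p) ℝ :=
  ∑ t, ∑ t' with t < t', (block (S.F₂ π) t t' + (block (S.F₂ π) t t')ᵀ)

noncomputable def Smat : Matrix (Fin p) (Fin n) ℝ := ∑ t, ∑ t', block (S.F₃ π) t t'

noncomputable def nv : Fin n → ℝ := fun i => ∑ t, S.f₁ π x₀ (t, i)

noncomputable def nw : Fin p → ℝ := fun i => ∑ t, S.f₂ π x₀ (t, i)

/-- The cost of the linear policy on the noise-free trajectory (all noises zero):
`qᵀ R q + (H q + L x₀)ᵀ Q (H q + L x₀)`. -/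
noncomputable def noiseFreeCost : ℝ :=
  S.q π x₀ ⬝ᵥ (S.stackedR *ᵥ S.q π x₀)
    + (S.stackedH *ᵥ S.q π x₀ + S.stackedL *ᵥ x₀) ⬝ᵥ
      (S.stackedQ *ᵥ (S.stackedH *ᵥ S.q π x₀ + S.stackedL *ᵥ x₀))

end LQSystem

/-- The affine map `x ↦ (I - P/l)⁻¹ x + c`; for `l = 0`, only used with `P = 0`, it is the
translation by `c`. -/
noncomputable def affinePush {d : ℕ} (P : Matrix (Fin d) (Fin d) ℝ) (l : ℝ)
    (c : EuclideanSpace ℝ (Fin d)) (x : EuclideanSpace ℝ (Fin d)) : EuclideanSpace ℝ (Fin d) :=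
  WithLp.toLp 2 ((1 - l⁻¹ • P)⁻¹ *ᵥ x.ofLp) + c

/-! ### The closed loop in purified-output form -/

namespace LQSystem

variable {n m p T : ℕ} (S : LQSystem n m p T)

/-! Along the closed loop the cost is a quadratic polynomial in the stacked noises. Because the
noises are independent and identically distributed on each side, its expectation sees a law `μ` only
through `E[xᵀ P_v x]` and the mean: diagonal blocks contribute second moments, off-diagonal blocks
factor into means (`integrable_trajectoryCost_and_cost_eq`). The maximisation over laws therefore
reduces to a finite-dimensional one.

Diagonalise `P_v = W diag(p) Wᵀ` with `p ≥ 0`, and let `σ i` be the standard deviation of the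
reference along the `i`-th eigenvector. For a coupling of `μ` with the reference, Cauchy–Schwarz in
each eigencoordinate gives `E X² ≤ (σ + s)² + a²`, where `a` is the mean of `X` and `s² + a²` is the
transport cost in that coordinate. Summing, `E[xᵀ P_v x]` is at most `∑ pᵢ (σᵢ + sᵢ)² + mᵀ P_v m`
with `‖s‖² + ‖m‖² ≤ ρ²` and `m` the mean (`exists_bound_of_mem_ambiguitySet`). So the cost is
bounded by a quadratic function on a product of two Euclidean balls, which has a maximiser by
compactness.

With the other side frozen, first-order conditions on the ball give a multiplier `r` with `r sᵢ = pᵢ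
(σᵢ + sᵢ)`, together with the linear equation for `m`. Replacing `s` by `|s|` shows that the optimal
`sᵢ` are nonnegative where `pᵢ > 0`; this yields `r > pᵢ` without second-order conditions, and `r >
0` makes the constraint active (`exists_multiplier_gt`). Then `sᵢ / σᵢ = pᵢ / (r - pᵢ)`, so `1 + sᵢ
/ σᵢ` are the eigenvalues of `(1 - r⁻¹ P)⁻¹`. The affine pushforward with this matrix is hence
feasible and attains the bound with equality (`resolvent_eq`, `worstCase_side`).

If `P_v = 0`, semidefiniteness forces every term containing `v` to vanish (`eq_zero_of_Pv_eq_zero`).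
The multiplier is then `0`, and `m_v` can be any vector of norm `ρ_v`, which exists since `n ≥ 1`.
The other side is symmetric. -/

theorem transition_self (t : ℕ) (ht : t ≤ T) : S.transition t t ht = 1 := by
  cases t with
  | zero => rfl
  | succ t => simp [transition]

theorem transition_succ {s t : ℕ} (hst : s ≤ t) (ht : t + 1 ≤ T) :
    S.transition s (t + 1) ht = S.A ⟨t, ht⟩ * S.transition s t (Nat.le_of_succ_le ht) := by
  simp [transition, hst]

theorem state_zero (x₀ : Fin n → ℝ) (π : Policy m p T)
    (v : Fin T → EuclideanSpace ℝ (Fin n)) (w : Fin T → EuclideanSpace ℝ (Fin p)) (h : 0 ≤ T) :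
    S.state x₀ π v w 0 h = x₀ := by
  rw [state]

theorem state_succ (x₀ : Fin n → ℝ) (π : Policy m p T)
    (v : Fin T → EuclideanSpace ℝ (Fin n)) (w : Fin T → EuclideanSpace ℝ (Fin p)) (t : ℕ)
    (h : t + 1 ≤ T) :
    S.state x₀ π v w (t + 1) h =
      S.A ⟨t, h⟩ *ᵥ S.state x₀ π v w t (Nat.le_of_succ_le h)
        + S.B ⟨t, h⟩ *ᵥ S.input x₀ π v w ⟨t, h⟩ + (v ⟨t, h⟩).ofLp := by
  rw [state]
  rfl

/-- The variation-of-constants formula for the closed-loop state. -/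
theorem state_eq_sum (x₀ : Fin n → ℝ) (π : Policy m p T)
    (v : Fin T → EuclideanSpace ℝ (Fin n)) (w : Fin T → EuclideanSpace ℝ (Fin p)) (t : ℕ)
    (h : t ≤ T) :
    S.state x₀ π v w t h =
      (∑ s : Fin T, if s.val < t then
        S.transition (s.val + 1) t h *ᵥ (S.B s *ᵥ S.input x₀ π v w s + (v s).ofLp) else 0)
      + S.transition 0 t h *ᵥ x₀ := by
  induction t with
  | zero => simp [state_zero, transition]
  | succ t ih =>
    rw [state_succ, ih (Nat.le_of_succ_le h), transition_succ S (Nat.zero_le t) h, mulVec_add,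
      mulVec_sum, mulVec_mulVec]
    -- Advancing from `t` to `t + 1` multiplies every old term by `A_t` and creates one new term, `s
    -- = t`, whose transition matrix is the identity.
    have key : ∀ s : Fin T,
        (if s.val < t + 1 then S.transition (s.val + 1) (t + 1) h *ᵥ
          (S.B s *ᵥ S.input x₀ π v w s + (v s).ofLp) else 0)
        = S.A ⟨t, h⟩ *ᵥ (if s.val < t then S.transition (s.val + 1) t (Nat.le_of_succ_le h) *ᵥ
            (S.B s *ᵥ S.input x₀ π v w s + (v s).ofLp) else 0)
          + (if s = ⟨t, h⟩ then S.B s *ᵥ S.input x₀ π v w s + (v s).ofLp else 0) := by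
      intro s
      rcases lt_trichotomy s.val t with hs | hs | hs
      · have h1 : s ≠ ⟨t, h⟩ := fun h' => by simp [h'] at hs
        rw [if_pos (by omega), if_pos hs, if_neg h1, transition_succ S (by omega) h,
          mulVec_mulVec, add_zero]
      · obtain rfl : s = ⟨t, h⟩ := Fin.ext hs
        simp [transition_self]
      · have h1 : s ≠ ⟨t, h⟩ := fun h' => by simp [h'] at hs
        rw [if_neg (by omega), if_neg (by omega), if_neg h1]
        simp
    simp_rw [key]
    rw [Finset.sum_add_distrib, Finset.sum_ite_eq' Finset.univ]
    simp only [Finset.mem_univ, if_true]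
    abel

end LQSystem

/-- The stacked vector of a finite trajectory of Euclidean vectors. -/
def stackE {d T : ℕ} (v : Fin T → EuclideanSpace ℝ (Fin d)) : Fin T × Fin d → ℝ :=
  fun a => v a.1 a.2

namespace LQSystem

variable {n m p T : ℕ} (S : LQSystem n m p T)

/-- The stacked closed-loop states. -/
noncomputable def stackedState (x₀ : Fin n → ℝ) (π : Policy m p T)
    (v : Fin T → EuclideanSpace ℝ (Fin n)) (w : Fin T → EuclideanSpace ℝ (Fin p)) :
    Fin (T + 1) × Fin n → ℝ :=
  fun a => S.state x₀ π v w a.1.val (Nat.le_of_lt_succ a.1.isLt) a.2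

/-- The stacked closed-loop outputs. -/
noncomputable def stackedOutput (x₀ : Fin n → ℝ) (π : Policy m p T)
    (v : Fin T → EuclideanSpace ℝ (Fin n)) (w : Fin T → EuclideanSpace ℝ (Fin p)) :
    Fin T × Fin p → ℝ :=
  fun a => S.output x₀ π v w a.1 a.2

/-- The stacked closed-loop inputs. -/
noncomputable def stackedInput (x₀ : Fin n → ℝ) (π : Policy m p T)
    (v : Fin T → EuclideanSpace ℝ (Fin n)) (w : Fin T → EuclideanSpace ℝ (Fin p)) :
    Fin T × Fin m → ℝ :=
  fun a => S.input x₀ π v w a.1 a.2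

theorem stackedState_eq (x₀ : Fin n → ℝ) (π : Policy m p T)
    (v : Fin T → EuclideanSpace ℝ (Fin n)) (w : Fin T → EuclideanSpace ℝ (Fin p)) :
    S.stackedState x₀ π v w = S.stackedH *ᵥ S.stackedInput x₀ π v w + S.stackedG *ᵥ stackE v
      + S.stackedL *ᵥ x₀ := by
  funext ⟨t, i⟩
  have h := congrFun (S.state_eq_sum x₀ π v w t.val (Nat.le_of_lt_succ t.isLt)) i
  simp only [stackedState]
  rw [h]
  simp only [Pi.add_apply, Finset.sum_apply]
  congr 1
  simp only [mulVec, dotProduct, Fintype.sum_prod_type]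
  rw [← Finset.sum_add_distrib]
  refine Finset.sum_congr rfl fun s _ => ?_
  by_cases hs : s.val < t.val
  · simp only [hs, if_true, stackedH, stackedG, Matrix.of_apply]
    rw [mulVec_add, mulVec_mulVec]
    rfl
  · simp [hs, stackedH, stackedG]

theorem stackedOutput_eq (x₀ : Fin n → ℝ) (π : Policy m p T)
    (v : Fin T → EuclideanSpace ℝ (Fin n)) (w : Fin T → EuclideanSpace ℝ (Fin p)) :
    S.stackedOutput x₀ π v w = S.stackedC *ᵥ S.stackedState x₀ π v w + stackE w := by
  funext ⟨t, i⟩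
  simp only [stackedOutput, output, Pi.add_apply, stackE]
  congr 1
  simp only [mulVec, dotProduct, Fintype.sum_prod_type, stackedC, Matrix.of_apply, ite_mul,
    zero_mul]
  rw [Finset.sum_eq_single t.castSucc]
  · simp [stackedState]
  · intro b _ hb
    simp [hb]
  · simp

theorem stackedInput_eq (x₀ : Fin n → ℝ) (π : LinearPolicy m p T)
    (v : Fin T → EuclideanSpace ℝ (Fin n)) (w : Fin T → EuclideanSpace ℝ (Fin p)) :
    S.stackedInput x₀ π.toPolicy v w
      = π.stackedK *ᵥ S.stackedOutput x₀ π.toPolicy v w + π.stackedk := by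
  funext ⟨t, i⟩
  simp only [stackedInput, input, LinearPolicy.toPolicy, Pi.add_apply, LinearPolicy.stackedk,
    Finset.sum_apply]
  congr 1
  simp only [mulVec, dotProduct, Fintype.sum_prod_type, LinearPolicy.stackedK, Matrix.of_apply]
  have ht : t.val + 1 ≤ T := t.isLt
  symm
  -- The policy sums over `Fin (t + 1)`, the stacked product over all of `Fin T`; the blocks beyond
  -- time `t` are zero, so the sum restricts to the image of the embedding.
  rw [← Finset.sum_subset (Finset.subset_univ (Finset.univ.map (Fin.castLEEmb ht)))]
  · rw [Finset.sum_map]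
    refine Finset.sum_congr rfl fun s _ => Finset.sum_congr rfl fun j _ => ?_
    have hs : (Fin.castLEEmb ht s).val < t.val + 1 := s.isLt
    rw [dif_pos hs]
    rfl
  · intro s _ hs
    have : ¬ s.val < t.val + 1 := fun hlt => hs (by
      simp only [Finset.mem_map, Finset.mem_univ, true_and]
      exact ⟨⟨s.val, hlt⟩, rfl⟩)
    simp [this]

/-- The loop gain is strictly block lower triangular. -/
theorem loopGain_apply_eq_zero (π : LinearPolicy m p T) {a b : Fin T × Fin m} (h : a.1 ≤ b.1) :
    (π.stackedK * S.stackedC * S.stackedH) a b = 0 := by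
  rw [Matrix.mul_assoc, Matrix.mul_apply]
  refine Finset.sum_eq_zero fun c _ => ?_
  by_cases hc : c.1.val < a.1.val + 1
  · have : (S.stackedC * S.stackedH) c b = 0 := by
      rw [Matrix.mul_apply]
      refine Finset.sum_eq_zero fun e _ => ?_
      by_cases he : e.1 = c.1.castSucc
      · have : ¬ b.1.val < e.1.val := by
          rw [he]
          have := Fin.le_def.mp h
          simp only [Fin.val_castSucc]
          omega
        simp [stackedH, this]
      · simp [stackedC, he]
    rw [this, mul_zero]
  · have hK : π.stackedK a c = 0 := by
      simp only [LinearPolicy.stackedK, Matrix.of_apply]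
      exact dif_neg hc
    rw [hK, zero_mul]

/-- A kernel vector satisfies `x = N x` with `N` strictly block lower triangular, so its blocks
vanish one after the other in time. For a square matrix, injectivity is enough. -/
theorem isUnit_one_sub_loopGain (π : LinearPolicy m p T) :
    IsUnit (1 - π.stackedK * S.stackedC * S.stackedH) := by
  rw [← Matrix.mulVec_injective_iff_isUnit]
  set N := π.stackedK * S.stackedC * S.stackedH with hN
  refine (injective_iff_map_eq_zero (Matrix.mulVecLin (1 - N))).2 fun x hx => ?_
  have hx' : x = N *ᵥ x := by
    simpa [sub_mulVec, sub_eq_zero] using hx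
  have key : ∀ k : ℕ, ∀ a : Fin T × Fin m, a.1.val < k → x a = 0 := by
    intro k
    induction k with
    | zero => intro a ha; omega
    | succ k ih =>
      intro a ha
      rw [hx']
      refine Finset.sum_eq_zero fun b _ => ?_
      by_cases hab : a.1 ≤ b.1
      · have hN0 : N a b = 0 := S.loopGain_apply_eq_zero π hab
        change N a b * x b = 0
        rw [hN0, zero_mul]
      · have : b.1.val < a.1.val := Fin.lt_def.mp (not_le.mp hab)
        rw [ih b (by omega), mul_zero]
  funext a
  exact key T a a.1.isLt

theorem stackedInput_eq_purified (x₀ : Fin n → ℝ) (π : LinearPolicy m p T)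
    (v : Fin T → EuclideanSpace ℝ (Fin n)) (w : Fin T → EuclideanSpace ℝ (Fin p)) :
    S.stackedInput x₀ π.toPolicy v w
      = S.U π *ᵥ (S.stackedD *ᵥ stackE v + stackE w) + S.q π x₀ := by
  have hu := S.stackedInput_eq x₀ π v w
  rw [stackedOutput_eq, stackedState_eq] at hu
  set u := S.stackedInput x₀ π.toPolicy v w
  set N := π.stackedK * S.stackedC * S.stackedH with hN
  have hdet : IsUnit (1 - N).det :=
    (Matrix.isUnit_iff_isUnit_det _).1 (S.isUnit_one_sub_loopGain π)
  -- After the output equation is substituted into the feedback law, the contributions `K C H u` on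
  -- both sides cancel.
  have h1 : (1 - N) *ᵥ u = π.stackedK *ᵥ (S.stackedD *ᵥ stackE v + stackE w)
      + (π.stackedk + π.stackedK *ᵥ (S.stackedC *ᵥ (S.stackedL *ᵥ x₀))) := by
    rw [sub_mulVec, one_mulVec]
    nth_rewrite 1 [hu]
    simp only [hN, stackedD, mulVec_add, mulVec_mulVec, Matrix.mul_assoc]
    abel
  have h2 : u = (1 - N)⁻¹ *ᵥ ((1 - N) *ᵥ u) := by
    rw [mulVec_mulVec, Matrix.nonsing_inv_mul _ hdet, one_mulVec]
  rw [h2, h1, mulVec_add, mulVec_mulVec, U, q]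

end LQSystem

/-- Expansion of a quadratic form along an affine map of two variables. -/
theorem quadratic_expand {α β γ : Type*} [Fintype α] [Fintype β] [Fintype γ]
    {Q : Matrix γ γ ℝ} (hQ : Qᵀ = Q) (A : Matrix γ α ℝ) (B : Matrix γ β ℝ) (c : γ → ℝ)
    (v : α → ℝ) (w : β → ℝ) :
    (A *ᵥ v + B *ᵥ w + c) ⬝ᵥ (Q *ᵥ (A *ᵥ v + B *ᵥ w + c))
      = v ⬝ᵥ ((Aᵀ * Q * A) *ᵥ v) + w ⬝ᵥ ((Bᵀ * Q * B) *ᵥ w) + 2 * (w ⬝ᵥ ((Bᵀ * Q * A) *ᵥ v))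
        + 2 * ((c ᵥ* (Q * A)) ⬝ᵥ v) + 2 * ((c ᵥ* (Q * B)) ⬝ᵥ w) + c ⬝ᵥ (Q *ᵥ c) := by
  have hs : ∀ x y : γ → ℝ, x ⬝ᵥ (Q *ᵥ y) = y ⬝ᵥ (Q *ᵥ x) := fun x y => by
    rw [dotProduct_mulVec, ← mulVec_transpose, hQ, dotProduct_comm]
  have e1 : v ⬝ᵥ ((Aᵀ * Q * A) *ᵥ v) = (A *ᵥ v) ⬝ᵥ (Q *ᵥ (A *ᵥ v)) := by
    rw [← mulVec_mulVec, ← mulVec_mulVec, dotProduct_mulVec, vecMul_transpose]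
  have e2 : w ⬝ᵥ ((Bᵀ * Q * B) *ᵥ w) = (B *ᵥ w) ⬝ᵥ (Q *ᵥ (B *ᵥ w)) := by
    rw [← mulVec_mulVec, ← mulVec_mulVec, dotProduct_mulVec, vecMul_transpose]
  have e3 : w ⬝ᵥ ((Bᵀ * Q * A) *ᵥ v) = (B *ᵥ w) ⬝ᵥ (Q *ᵥ (A *ᵥ v)) := by
    rw [← mulVec_mulVec, ← mulVec_mulVec, dotProduct_mulVec, vecMul_transpose]
  have e4 : (c ᵥ* (Q * A)) ⬝ᵥ v = c ⬝ᵥ (Q *ᵥ (A *ᵥ v)) := by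
    rw [← dotProduct_mulVec, mulVec_mulVec]
  have e5 : (c ᵥ* (Q * B)) ⬝ᵥ w = c ⬝ᵥ (Q *ᵥ (B *ᵥ w)) := by
    rw [← dotProduct_mulVec, mulVec_mulVec]
  rw [e1, e2, e3, e4, e5]
  simp only [mulVec_add, dotProduct_add, add_dotProduct]
  rw [hs (A *ᵥ v) (B *ᵥ w), hs (A *ᵥ v) c, hs (B *ᵥ w) c]
  ring

/-! ### The trajectory cost as a quadratic polynomial in the noises -/

namespace LQSystem

variable {n m p T : ℕ} (S : LQSystem n m p T)

theorem stackedQ_transpose (hQ : ∀ t, (S.Q t).IsHermitian) : S.stackedQᵀ = S.stackedQ := by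
  ext a b
  by_cases h : a.1 = b.1
  · have := (hQ a.1).apply a.2 b.2
    simp only [star_trivial] at this
    simp [stackedQ, h.symm, this]
  · have h' : b.1 ≠ a.1 := fun e => h e.symm
    simp [stackedQ, h, h']

theorem stackedR_transpose (hR : ∀ t, (S.R t).IsHermitian) : S.stackedRᵀ = S.stackedR := by
  ext a b
  by_cases h : a.1 = b.1
  · have := (hR a.1).apply a.2 b.2
    simp only [star_trivial] at this
    simp [stackedR, h.symm, this]
  · have h' : b.1 ≠ a.1 := fun e => h e.symm
    simp [stackedR, h, h']

theorem dotProduct_stackedQ (x : Fin (T + 1) × Fin n → ℝ) :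
    x ⬝ᵥ (S.stackedQ *ᵥ x) = ∑ t, (fun i => x (t, i)) ⬝ᵥ (S.Q t *ᵥ fun i => x (t, i)) := by
  simp only [dotProduct, mulVec, Fintype.sum_prod_type, stackedQ, Matrix.of_apply]
  refine Finset.sum_congr rfl fun t _ => Finset.sum_congr rfl fun i _ => ?_
  rw [Finset.sum_eq_single t]
  · simp
  · intro b _ hb
    simp [hb.symm]
  · simp

theorem dotProduct_stackedR (x : Fin T × Fin m → ℝ) :
    x ⬝ᵥ (S.stackedR *ᵥ x) = ∑ t, (fun i => x (t, i)) ⬝ᵥ (S.R t *ᵥ fun i => x (t, i)) := by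
  simp only [dotProduct, mulVec, Fintype.sum_prod_type, stackedR, Matrix.of_apply]
  refine Finset.sum_congr rfl fun t _ => Finset.sum_congr rfl fun i _ => ?_
  rw [Finset.sum_eq_single t]
  · simp
  · intro b _ hb
    simp [hb.symm]
  · simp

/-- The closed-loop cost is a quadratic function of the stacked noises. -/
theorem trajectoryCost_eq (hQ : ∀ t, (S.Q t).IsHermitian) (hR : ∀ t, (S.R t).IsHermitian)
    (x₀ : Fin n → ℝ) (π : LinearPolicy m p T)
    (v : Fin T → EuclideanSpace ℝ (Fin n)) (w : Fin T → EuclideanSpace ℝ (Fin p)) :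
    S.trajectoryCost x₀ π.toPolicy v w =
      S.noiseFreeCost π x₀ + stackE v ⬝ᵥ (S.F₁ π *ᵥ stackE v) + stackE w ⬝ᵥ (S.F₂ π *ᵥ stackE w)
        + stackE w ⬝ᵥ (S.F₃ π *ᵥ stackE v) + S.f₁ π x₀ ⬝ᵥ stackE v + S.f₂ π x₀ ⬝ᵥ stackE w := by
  have h0 : S.trajectoryCost x₀ π.toPolicy v w
      = S.stackedState x₀ π.toPolicy v w ⬝ᵥ (S.stackedQ *ᵥ S.stackedState x₀ π.toPolicy v w)
        + S.stackedInput x₀ π.toPolicy v w ⬝ᵥ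
          (S.stackedR *ᵥ S.stackedInput x₀ π.toPolicy v w) := by
    rw [dotProduct_stackedQ, dotProduct_stackedR]
    rfl
  have hu : S.stackedInput x₀ π.toPolicy v w
      = (S.U π * S.stackedD) *ᵥ stackE v + S.U π *ᵥ stackE w + S.q π x₀ := by
    rw [stackedInput_eq_purified, mulVec_add, mulVec_mulVec]
  have hx : S.stackedState x₀ π.toPolicy v w
      = (S.stackedH * S.U π * S.stackedD + S.stackedG) *ᵥ stackE v
        + (S.stackedH * S.U π) *ᵥ stackE w
        + (S.stackedH *ᵥ S.q π x₀ + S.stackedL *ᵥ x₀) := by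
    rw [stackedState_eq, hu]
    simp only [mulVec_add, add_mulVec, mulVec_mulVec, Matrix.mul_assoc]
    abel
  rw [h0, hx, hu, quadratic_expand (S.stackedQ_transpose hQ),
    quadratic_expand (S.stackedR_transpose hR)]
  -- The noise-free state is written as a row vector, the form in which it enters `f₁` and `f₂`.
  have hc : (S.stackedH *ᵥ S.q π x₀ + S.stackedL *ᵥ x₀)
      = S.q π x₀ ᵥ* S.stackedHᵀ + x₀ ᵥ* S.stackedLᵀ := by
    rw [vecMul_transpose, vecMul_transpose]
  simp only [noiseFreeCost, F₁, F₂, F₃, f₁, f₂]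
  rw [hc]
  simp only [add_vecMul, vecMul_vecMul, vecMul_add, add_mulVec, smul_mulVec, dotProduct_add,
    add_dotProduct, dotProduct_smul, smul_dotProduct, smul_eq_mul, Matrix.mul_add, Matrix.add_mul,
    Matrix.transpose_mul, Matrix.transpose_add, Matrix.mul_assoc]
  ring

end LQSystem

/-! ### Expectations of quadratic functions of independent noises -/

section Bilinear

theorem integral_add₆ {Ω : Type*} [MeasurableSpace Ω] {P : Measure Ω} {f₀ f₁ f₂ f₃ f₄ f₅ : Ω → ℝ}
    (h₀ : Integrable f₀ P) (h₁ : Integrable f₁ P) (h₂ : Integrable f₂ P) (h₃ : Integrable f₃ P)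
    (h₄ : Integrable f₄ P) (h₅ : Integrable f₅ P) :
    ∫ ω, f₀ ω + f₁ ω + f₂ ω + f₃ ω + f₄ ω + f₅ ω ∂P
      = ∫ ω, f₀ ω ∂P + ∫ ω, f₁ ω ∂P + ∫ ω, f₂ ω ∂P + ∫ ω, f₃ ω ∂P + ∫ ω, f₄ ω ∂P
        + ∫ ω, f₅ ω ∂P := by
  have h01 := h₀.add h₁
  have h02 := h01.add h₂
  have h03 := h02.add h₃
  rw [← integral_add' h₀ h₁, ← integral_add' h01 h₂, ← integral_add' h02 h₃, ← integral_add' h03 h₄,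
    ← integral_add' (h03.add h₄) h₅]
  rfl

variable {Ω : Type*} [MeasurableSpace Ω] {P : Measure Ω}

/-- Transfers independence of the coordinates under a single `Measure.pi` to the joint noise law,
through the projections onto its two factors. -/
theorem ProbabilityTheory.IndepFun.comp_measurePreserving {Ω' α β : Type*} [MeasurableSpace Ω']
    [MeasurableSpace α] [MeasurableSpace β] {P' : Measure Ω'} {f : Ω' → α} {g : Ω' → β}
    (h : IndepFun f g P') (hf : Measurable f) (hg : Measurable g) {φ : Ω → Ω'}
    (hφ : MeasurePreserving φ P P') : IndepFun (fun ω => f (φ ω)) (fun ω => g (φ ω)) P := by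
  rw [indepFun_iff_measure_inter_preimage_eq_mul] at h ⊢
  intro s t hs ht
  have := h s t hs ht
  rw [← hφ.measure_preimage (hf hs).nullMeasurableSet,
    ← hφ.measure_preimage (hg ht).nullMeasurableSet,
    ← hφ.measure_preimage ((hf hs).inter (hg ht)).nullMeasurableSet] at this
  exact this

variable {a b : ℕ} {X : Ω → EuclideanSpace ℝ (Fin a)} {Y : Ω → EuclideanSpace ℝ (Fin b)}

theorem integrable_dotProduct_mulVec (hX : MemLp X 2 P) (hY : MemLp Y 2 P)
    (M : Matrix (Fin a) (Fin b) ℝ) :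
    Integrable (fun ω => (X ω).ofLp ⬝ᵥ (M *ᵥ (Y ω).ofLp)) P := by
  simp only [dotProduct, mulVec, Finset.mul_sum]
  refine integrable_finsetSum _ fun i _ => integrable_finsetSum _ fun j _ => ?_
  have h := ((hX.eval_piLp i).integrable_mul (hY.eval_piLp j)).const_mul (M i j)
  refine h.congr (ae_of_all _ fun ω => ?_)
  simp only [Pi.mul_apply]
  ring

theorem integrable_dotProduct [IsFiniteMeasure P] (hX : MemLp X 2 P) (c : Fin a → ℝ) :
    Integrable (fun ω => c ⬝ᵥ (X ω).ofLp) P := by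
  simp only [dotProduct]
  exact integrable_finsetSum _ fun i _ =>
    ((hX.eval_piLp i).integrable one_le_two).const_mul (c i)

theorem integral_apply_of_memLp [IsFiniteMeasure P] (hX : MemLp X 2 P) (i : Fin a) :
    ∫ ω, X ω i ∂P = (∫ ω, X ω ∂P) i :=
  (eval_integral_piLp (fun i => (hX.eval_piLp i).integrable one_le_two) i).symm

theorem integral_dotProduct [IsFiniteMeasure P] (hX : MemLp X 2 P) (c : Fin a → ℝ) :
    ∫ ω, c ⬝ᵥ (X ω).ofLp ∂P = c ⬝ᵥ (∫ ω, X ω ∂P).ofLp := by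
  simp only [dotProduct]
  rw [integral_finsetSum _ fun i _ => ((hX.eval_piLp i).integrable one_le_two).const_mul (c i)]
  refine Finset.sum_congr rfl fun i _ => ?_
  rw [integral_const_mul, integral_apply_of_memLp hX]

/-- Independence factorises each product of coordinates; this is why off-diagonal and mixed blocks
contribute through the means only. -/
theorem integral_dotProduct_mulVec_of_indepFun [IsFiniteMeasure P] (hX : MemLp X 2 P)
    (hY : MemLp Y 2 P) (hXY : IndepFun X Y P) (M : Matrix (Fin a) (Fin b) ℝ) :
    ∫ ω, (X ω).ofLp ⬝ᵥ (M *ᵥ (Y ω).ofLp) ∂P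
      = (∫ ω, X ω ∂P).ofLp ⬝ᵥ (M *ᵥ (∫ ω, Y ω ∂P).ofLp) := by
  have hint : ∀ i j, Integrable (fun ω => X ω i * (M i j * Y ω j)) P := fun i j => by
    have h := ((hX.eval_piLp i).integrable_mul (hY.eval_piLp j)).const_mul (M i j)
    refine h.congr (ae_of_all _ fun ω => ?_)
    simp only [Pi.mul_apply]
    ring
  simp only [dotProduct, mulVec, Finset.mul_sum]
  rw [integral_finsetSum _ fun i _ => integrable_finsetSum _ fun j _ => hint i j]
  refine Finset.sum_congr rfl fun i _ => ?_
  rw [integral_finsetSum _ fun j _ => hint i j]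
  refine Finset.sum_congr rfl fun j _ => ?_
  have hI : IndepFun (fun ω => X ω i) (fun ω => Y ω j) P :=
    hXY.comp (φ := fun x : EuclideanSpace ℝ (Fin a) => x i)
      (ψ := fun y : EuclideanSpace ℝ (Fin b) => y j) (by fun_prop) (by fun_prop)
  have h := hI.integral_fun_mul_eq_mul_integral (hX.eval_piLp i).1 (hY.eval_piLp j).1
  rw [integral_apply_of_memLp hX, integral_apply_of_memLp hY] at h
  have h2 : ∀ ω, X ω i * (M i j * Y ω j) = M i j * (X ω i * Y ω j) := fun ω => by ring
  simp_rw [h2]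
  rw [integral_const_mul, h]
  ring

end Bilinear

theorem dotProduct_stackE {a b T : ℕ} (F : Matrix (Fin T × Fin a) (Fin T × Fin b) ℝ)
    (v : Fin T → EuclideanSpace ℝ (Fin a)) (w : Fin T → EuclideanSpace ℝ (Fin b)) :
    stackE v ⬝ᵥ (F *ᵥ stackE w)
      = ∑ t, ∑ t', (v t).ofLp ⬝ᵥ (LQSystem.block F t t' *ᵥ (w t').ofLp) := by
  simp only [dotProduct, mulVec, Fintype.sum_prod_type, LQSystem.block, stackE,
    Matrix.submatrix_apply, Finset.mul_sum]
  refine Finset.sum_congr rfl fun t _ => ?_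
  rw [Finset.sum_comm]

theorem dotProduct_stackE_left {a T : ℕ} (f : Fin T × Fin a → ℝ)
    (v : Fin T → EuclideanSpace ℝ (Fin a)) :
    f ⬝ᵥ stackE v = ∑ t, (fun i => f (t, i)) ⬝ᵥ (v t).ofLp := by
  simp only [dotProduct, Fintype.sum_prod_type, stackE]

/-- Splitting a double sum over blocks of a symmetric matrix into its diagonal and upper part. -/
theorem sum_block_eq {a T : ℕ} {F : Matrix (Fin T × Fin a) (Fin T × Fin a) ℝ} (hF : Fᵀ = F)
    (d : Fin T → ℝ) (x : Fin a → ℝ) :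
    (∑ t, ∑ t', if t = t' then d t else x ⬝ᵥ (LQSystem.block F t t' *ᵥ x))
      = ∑ t, d t + x ⬝ᵥ ((∑ t, ∑ t' with t < t',
          (LQSystem.block F t t' + (LQSystem.block F t t')ᵀ)) *ᵥ x) := by
  have hsymm : ∀ t t', LQSystem.block F t' t = (LQSystem.block F t t')ᵀ := fun t t' => by
    ext i j
    simpa [LQSystem.block] using congrFun (congrFun hF (t', i)) (t, j) |>.symm
  -- Diagonal, upper and lower blocks. After exchanging the two summations, the lower part is the
  -- transpose of the upper one by symmetry of `F`.
  have hsplit : ∀ t t' : Fin T,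
      (if t = t' then d t else x ⬝ᵥ (LQSystem.block F t t' *ᵥ x))
        = (if t = t' then d t else 0)
          + ((if t < t' then x ⬝ᵥ (LQSystem.block F t t' *ᵥ x) else 0)
          + (if t' < t then x ⬝ᵥ (LQSystem.block F t t' *ᵥ x) else 0)) := by
    intro t t'
    rcases lt_trichotomy t t' with h | h | h
    · simp [h, h.ne, h.not_gt]
    · simp [h]
    · simp [h, h.ne', h.not_gt]
  simp_rw [hsplit, Finset.sum_add_distrib]
  congr 1
  · simp
  · rw [Finset.sum_comm (f := fun t t' =>
      if t' < t then x ⬝ᵥ (LQSystem.block F t t' *ᵥ x) else 0)]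
    simp only [sum_mulVec, dotProduct_sum, Finset.sum_filter, add_mulVec, dotProduct_add]
    simp only [← Finset.sum_add_distrib]
    refine Finset.sum_congr rfl fun t _ => Finset.sum_congr rfl fun t' _ => ?_
    split_ifs with h
    · rw [hsymm t t']
    · simp

namespace LQSystem

variable {n m p T : ℕ} (S : LQSystem n m p T)

theorem F₁_transpose (hQ : ∀ t, (S.Q t).IsHermitian) (hR : ∀ t, (S.R t).IsHermitian)
    (π : LinearPolicy m p T) : (S.F₁ π)ᵀ = S.F₁ π := by
  simp only [F₁, Matrix.transpose_add, Matrix.transpose_mul, Matrix.transpose_transpose,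
    S.stackedQ_transpose hQ, S.stackedR_transpose hR, Matrix.mul_assoc]

theorem F₂_transpose (hQ : ∀ t, (S.Q t).IsHermitian) (hR : ∀ t, (S.R t).IsHermitian)
    (π : LinearPolicy m p T) : (S.F₂ π)ᵀ = S.F₂ π := by
  simp only [F₂, Matrix.transpose_add, Matrix.transpose_mul, Matrix.transpose_transpose,
    S.stackedQ_transpose hQ, S.stackedR_transpose hR, Matrix.mul_assoc]

/-- The expected cost as a function of the first two moments of the noise laws. -/
theorem integrable_trajectoryCost_and_cost_eq (hQ : ∀ t, (S.Q t).IsHermitian)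
    (hR : ∀ t, (S.R t).IsHermitian) (x₀ : Fin n → ℝ) (π : LinearPolicy m p T)
    (μ : Measure (EuclideanSpace ℝ (Fin n))) (ν : Measure (EuclideanSpace ℝ (Fin p)))
    [IsProbabilityMeasure μ] [IsProbabilityMeasure ν] (hμ : MemLp id 2 μ) (hν : MemLp id 2 ν) :
    Integrable (fun z => S.trajectoryCost x₀ π.toPolicy z.1 z.2) (noiseLaw T μ ν) ∧
    S.cost x₀ π.toPolicy μ ν = S.noiseFreeCost π x₀
      + (∫ x, x.ofLp ⬝ᵥ (S.Pv π *ᵥ x.ofLp) ∂μ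
        + (∫ x, x ∂μ).ofLp ⬝ᵥ (S.Nv π *ᵥ (∫ x, x ∂μ).ofLp))
      + (∫ y, y.ofLp ⬝ᵥ (S.Pw π *ᵥ y.ofLp) ∂ν
        + (∫ y, y ∂ν).ofLp ⬝ᵥ (S.Nw π *ᵥ (∫ y, y ∂ν).ofLp))
      + (∫ y, y ∂ν).ofLp ⬝ᵥ (S.Smat π *ᵥ (∫ x, x ∂μ).ofLp)
      + S.nv π x₀ ⬝ᵥ (∫ x, x ∂μ).ofLp + S.nw π x₀ ⬝ᵥ (∫ y, y ∂ν).ofLp := by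
  set L := noiseLaw T μ ν with hL
  have hprob : IsProbabilityMeasure L := by
    rw [hL, noiseLaw]
    infer_instance
  have hX : ∀ t, MeasurePreserving (fun z : (Fin T → EuclideanSpace ℝ (Fin n)) ×
      (Fin T → EuclideanSpace ℝ (Fin p)) => z.1 t) L μ := fun t =>
    (measurePreserving_eval (fun _ : Fin T => μ) t).comp measurePreserving_fst
  have hY : ∀ t, MeasurePreserving (fun z : (Fin T → EuclideanSpace ℝ (Fin n)) ×
      (Fin T → EuclideanSpace ℝ (Fin p)) => z.2 t) L ν := fun t =>
    (measurePreserving_eval (fun _ : Fin T => ν) t).comp measurePreserving_snd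
  have hX2 : ∀ t, MemLp (fun z : (Fin T → EuclideanSpace ℝ (Fin n)) ×
      (Fin T → EuclideanSpace ℝ (Fin p)) => z.1 t) 2 L := fun t =>
    hμ.comp_measurePreserving (hX t)
  have hY2 : ∀ t, MemLp (fun z : (Fin T → EuclideanSpace ℝ (Fin n)) ×
      (Fin T → EuclideanSpace ℝ (Fin p)) => z.2 t) 2 L := fun t =>
    hν.comp_measurePreserving (hY t)
  have hXm : ∀ t, ∫ z, z.1 t ∂L = ∫ x, x ∂μ := fun t => by
    have := integral_map (μ := L) (hX t).measurable.aemeasurable (f := fun x => x)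
      (by fun_prop)
    rw [(hX t).map_eq] at this
    exact this.symm
  have hYm : ∀ t, ∫ z, z.2 t ∂L = ∫ x, x ∂ν := fun t => by
    have := integral_map (μ := L) (hY t).measurable.aemeasurable (f := fun x => x)
      (by fun_prop)
    rw [(hY t).map_eq] at this
    exact this.symm
  have hXX : ∀ t t', t ≠ t' → IndepFun (fun z : (Fin T → EuclideanSpace ℝ (Fin n)) ×
      (Fin T → EuclideanSpace ℝ (Fin p)) => z.1 t) (fun z => z.1 t') L := fun t t' htt => by
    have h := (iIndepFun_pi (μ := fun _ : Fin T => μ)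
      (X := fun _ (x : EuclideanSpace ℝ (Fin n)) => x) (fun _ => aemeasurable_id)).indepFun htt
    exact h.comp_measurePreserving (by fun_prop) (by fun_prop) measurePreserving_fst
  have hYY : ∀ t t', t ≠ t' → IndepFun (fun z : (Fin T → EuclideanSpace ℝ (Fin n)) ×
      (Fin T → EuclideanSpace ℝ (Fin p)) => z.2 t) (fun z => z.2 t') L := fun t t' htt => by
    have h := (iIndepFun_pi (μ := fun _ : Fin T => ν)
      (X := fun _ (x : EuclideanSpace ℝ (Fin p)) => x) (fun _ => aemeasurable_id)).indepFun htt
    exact h.comp_measurePreserving (by fun_prop) (by fun_prop) measurePreserving_snd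
  have hYX : ∀ t t', IndepFun (fun z : (Fin T → EuclideanSpace ℝ (Fin n)) ×
      (Fin T → EuclideanSpace ℝ (Fin p)) => z.2 t) (fun z => z.1 t') L := fun t t' =>
    (indepFun_prod (X := fun v : Fin T → EuclideanSpace ℝ (Fin n) => v t')
      (Y := fun w : Fin T → EuclideanSpace ℝ (Fin p) => w t) (by fun_prop) (by fun_prop)).symm
  have hXdiag : ∀ t (M : Matrix (Fin n) (Fin n) ℝ),
      ∫ z, (z.1 t).ofLp ⬝ᵥ (M *ᵥ (z.1 t).ofLp) ∂L = ∫ x, x.ofLp ⬝ᵥ (M *ᵥ x.ofLp) ∂μ :=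
    fun t M => by
    have hm : Continuous fun x : EuclideanSpace ℝ (Fin n) => x.ofLp ⬝ᵥ (M *ᵥ x.ofLp) := by
      simp only [dotProduct, mulVec]
      fun_prop
    have := integral_map (μ := L) (hX t).measurable.aemeasurable
      (f := fun x : EuclideanSpace ℝ (Fin n) => x.ofLp ⬝ᵥ (M *ᵥ x.ofLp))
      hm.aestronglyMeasurable
    rw [(hX t).map_eq] at this
    exact this.symm
  have hYdiag : ∀ t (M : Matrix (Fin p) (Fin p) ℝ),
      ∫ z, (z.2 t).ofLp ⬝ᵥ (M *ᵥ (z.2 t).ofLp) ∂L = ∫ x, x.ofLp ⬝ᵥ (M *ᵥ x.ofLp) ∂ν :=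
    fun t M => by
    have hm : Continuous fun x : EuclideanSpace ℝ (Fin p) => x.ofLp ⬝ᵥ (M *ᵥ x.ofLp) := by
      simp only [dotProduct, mulVec]
      fun_prop
    have := integral_map (μ := L) (hY t).measurable.aemeasurable
      (f := fun x : EuclideanSpace ℝ (Fin p) => x.ofLp ⬝ᵥ (M *ᵥ x.ofLp))
      hm.aestronglyMeasurable
    rw [(hY t).map_eq] at this
    exact this.symm
  simp only [cost, ← hL]
  simp_rw [S.trajectoryCost_eq hQ hR x₀ π, dotProduct_stackE, dotProduct_stackE_left]
  have i1 := integrable_finsetSum Finset.univ fun t _ => integrable_finsetSum Finset.univ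
    fun t' _ => integrable_dotProduct_mulVec (hX2 t) (hX2 t') (block (S.F₁ π) t t')
  have i2 := integrable_finsetSum Finset.univ fun t _ => integrable_finsetSum Finset.univ
    fun t' _ => integrable_dotProduct_mulVec (hY2 t) (hY2 t') (block (S.F₂ π) t t')
  have i3 := integrable_finsetSum Finset.univ fun t _ => integrable_finsetSum Finset.univ
    fun t' _ => integrable_dotProduct_mulVec (hY2 t) (hX2 t') (block (S.F₃ π) t t')
  have i4 := integrable_finsetSum Finset.univ fun t _ =>
    integrable_dotProduct (hX2 t) (fun i => S.f₁ π x₀ (t, i))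
  have i5 := integrable_finsetSum Finset.univ fun t _ =>
    integrable_dotProduct (hY2 t) (fun i => S.f₂ π x₀ (t, i))
  have i0 := integrable_const (μ := L) (S.noiseFreeCost π x₀)
  refine ⟨((((i0.add i1).add i2).add i3).add i4).add i5, ?_⟩
  rw [integral_add₆ i0 i1 i2 i3 i4 i5]
  have e1 : ∫ z, ∑ t, ∑ t', (z.1 t).ofLp ⬝ᵥ (block (S.F₁ π) t t' *ᵥ (z.1 t').ofLp) ∂L
      = ∫ x, x.ofLp ⬝ᵥ (S.Pv π *ᵥ x.ofLp) ∂μ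
        + (∫ x, x ∂μ).ofLp ⬝ᵥ (S.Nv π *ᵥ (∫ x, x ∂μ).ofLp) := by
    rw [integral_finsetSum _ fun t _ => integrable_finsetSum Finset.univ
      fun t' _ => integrable_dotProduct_mulVec (hX2 t) (hX2 t') (block (S.F₁ π) t t')]
    have : ∀ t, ∫ z, ∑ t', (z.1 t).ofLp ⬝ᵥ (block (S.F₁ π) t t' *ᵥ (z.1 t').ofLp) ∂L
        = ∑ t', if t = t' then ∫ x, x.ofLp ⬝ᵥ (block (S.F₁ π) t t *ᵥ x.ofLp) ∂μ
          else (∫ x, x ∂μ).ofLp ⬝ᵥ (block (S.F₁ π) t t' *ᵥ (∫ x, x ∂μ).ofLp) := fun t => by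
      rw [integral_finsetSum _ fun t' _ =>
        integrable_dotProduct_mulVec (hX2 t) (hX2 t') (block (S.F₁ π) t t')]
      refine Finset.sum_congr rfl fun t' _ => ?_
      split_ifs with h
      · subst h
        exact hXdiag t _
      · rw [integral_dotProduct_mulVec_of_indepFun (hX2 t) (hX2 t') (hXX t t' h), hXm, hXm]
    simp_rw [this]
    rw [sum_block_eq (S.F₁_transpose hQ hR π), Nv, Pv]
    congr 1
    simp_rw [sum_mulVec, dotProduct_sum]
    exact (integral_finsetSum _ fun t _ => integrable_dotProduct_mulVec hμ hμ _).symm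
  have e2 : ∫ z, ∑ t, ∑ t', (z.2 t).ofLp ⬝ᵥ (block (S.F₂ π) t t' *ᵥ (z.2 t').ofLp) ∂L
      = ∫ x, x.ofLp ⬝ᵥ (S.Pw π *ᵥ x.ofLp) ∂ν
        + (∫ x, x ∂ν).ofLp ⬝ᵥ (S.Nw π *ᵥ (∫ x, x ∂ν).ofLp) := by
    rw [integral_finsetSum _ fun t _ => integrable_finsetSum Finset.univ
      fun t' _ => integrable_dotProduct_mulVec (hY2 t) (hY2 t') (block (S.F₂ π) t t')]
    have : ∀ t, ∫ z, ∑ t', (z.2 t).ofLp ⬝ᵥ (block (S.F₂ π) t t' *ᵥ (z.2 t').ofLp) ∂L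
        = ∑ t', if t = t' then ∫ x, x.ofLp ⬝ᵥ (block (S.F₂ π) t t *ᵥ x.ofLp) ∂ν
          else (∫ x, x ∂ν).ofLp ⬝ᵥ (block (S.F₂ π) t t' *ᵥ (∫ x, x ∂ν).ofLp) := fun t => by
      rw [integral_finsetSum _ fun t' _ =>
        integrable_dotProduct_mulVec (hY2 t) (hY2 t') (block (S.F₂ π) t t')]
      refine Finset.sum_congr rfl fun t' _ => ?_
      split_ifs with h
      · subst h
        exact hYdiag t _
      · rw [integral_dotProduct_mulVec_of_indepFun (hY2 t) (hY2 t') (hYY t t' h), hYm, hYm]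
    simp_rw [this]
    rw [sum_block_eq (S.F₂_transpose hQ hR π), Nw, Pw]
    congr 1
    simp_rw [sum_mulVec, dotProduct_sum]
    exact (integral_finsetSum _ fun t _ => integrable_dotProduct_mulVec hν hν _).symm
  have e3 : ∫ z, ∑ t, ∑ t', (z.2 t).ofLp ⬝ᵥ (block (S.F₃ π) t t' *ᵥ (z.1 t').ofLp) ∂L
      = (∫ y, y ∂ν).ofLp ⬝ᵥ (S.Smat π *ᵥ (∫ x, x ∂μ).ofLp) := by
    rw [integral_finsetSum _ fun t _ => integrable_finsetSum Finset.univ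
      fun t' _ => integrable_dotProduct_mulVec (hY2 t) (hX2 t') (block (S.F₃ π) t t')]
    simp_rw [Smat, sum_mulVec, dotProduct_sum]
    refine Finset.sum_congr rfl fun t _ => ?_
    rw [integral_finsetSum _ fun t' _ =>
      integrable_dotProduct_mulVec (hY2 t) (hX2 t') (block (S.F₃ π) t t')]
    refine Finset.sum_congr rfl fun t' _ => ?_
    rw [integral_dotProduct_mulVec_of_indepFun (hY2 t) (hX2 t') (hYX t t'), hXm, hYm]
  have e4 : ∫ z, ∑ t, (fun i => S.f₁ π x₀ (t, i)) ⬝ᵥ (z.1 t).ofLp ∂L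
      = S.nv π x₀ ⬝ᵥ (∫ x, x ∂μ).ofLp := by
    rw [integral_finsetSum _ fun t _ => integrable_dotProduct (hX2 t) _]
    have : S.nv π x₀ = ∑ t, fun i => S.f₁ π x₀ (t, i) := by
      funext i
      simp [nv]
    rw [this, sum_dotProduct]
    refine Finset.sum_congr rfl fun t _ => ?_
    rw [integral_dotProduct (hX2 t), hXm]
  have e5 : ∫ z, ∑ t, (fun i => S.f₂ π x₀ (t, i)) ⬝ᵥ (z.2 t).ofLp ∂L
      = S.nw π x₀ ⬝ᵥ (∫ y, y ∂ν).ofLp := by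
    rw [integral_finsetSum _ fun t _ => integrable_dotProduct (hY2 t) _]
    have : S.nw π x₀ = ∑ t, fun i => S.f₂ π x₀ (t, i) := by
      funext i
      simp [nw]
    rw [this, sum_dotProduct]
    refine Finset.sum_congr rfl fun t _ => ?_
    rw [integral_dotProduct (hY2 t), hYm]
  rw [e1, e2, e3, e4, e5]
  simp

end LQSystem

/-! ### Quadratic maximisation over products of balls -/

/-- Lagrange multipliers for the maximum of a quadratic function on a ball. -/
theorem exists_multiplier_of_isMax_ball {E : Type*} [NormedAddCommGroup E] [InnerProductSpace ℝ E]
    {ρ : ℝ} {φ : E → ℝ} {z : E} (hρ : 0 < ρ) (hz : ‖z‖ ≤ ρ)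
    (hmax : ∀ y, ‖y‖ ≤ ρ → φ y ≤ φ z) (l : E →ₗ[ℝ] ℝ) (B : E → ℝ)
    (hB : ∀ (t : ℝ) d, B (t • d) = t ^ 2 * B d) (hφ : ∀ d, φ (z + d) = φ z + l d + B d) :
    ∃ c : ℝ, (∀ d, l d = c * inner ℝ z d) ∧ (‖z‖ < ρ → c = 0) := by
  -- Small steps along `d` stay in the ball if `z` is interior or `d` points strictly inward.
  -- Dividing `φ (z + t d) ≤ φ z` by `t` and letting `t → 0+` leaves the linear part.
  have hA : ∀ d, (‖z‖ < ρ ∨ inner ℝ z d < 0) → l d ≤ 0 := by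
    intro d hd
    have hfeas : ∀ᶠ t : ℝ in nhdsWithin 0 (Set.Ioi 0), ‖z + t • d‖ ≤ ρ := by
      rcases hd with hd | hd
      · have hc : Filter.Tendsto (fun t : ℝ => ‖z + t • d‖) (nhdsWithin 0 (Set.Ioi 0))
            (nhds ‖z + (0 : ℝ) • d‖) :=
          (Continuous.tendsto (by fun_prop) 0).mono_left nhdsWithin_le_nhds
        rw [zero_smul, add_zero] at hc
        exact (hc.eventually (gt_mem_nhds hd)).mono fun t ht => le_of_lt ht
      · have hc : Filter.Tendsto (fun t : ℝ => 2 * inner ℝ z d + t * ‖d‖ ^ 2)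
            (nhdsWithin 0 (Set.Ioi 0)) (nhds (2 * inner ℝ z d + 0 * ‖d‖ ^ 2)) :=
          (Continuous.tendsto (by fun_prop) 0).mono_left nhdsWithin_le_nhds
        have hneg : 2 * inner ℝ z d + 0 * ‖d‖ ^ 2 < 0 := by linarith
        filter_upwards [hc.eventually (gt_mem_nhds hneg), self_mem_nhdsWithin] with t ht ht0
        have ht0 : 0 < t := ht0
        have h1 : ‖z + t • d‖ ^ 2 = ‖z‖ ^ 2 + t * (2 * inner ℝ z d + t * ‖d‖ ^ 2) := by
          rw [norm_add_sq_real, inner_smul_right, norm_smul, Real.norm_eq_abs, mul_pow, sq_abs]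
          ring
        have h2 : ‖z + t • d‖ ^ 2 ≤ ρ ^ 2 := by
          rw [h1]
          have := mul_neg_of_pos_of_neg ht0 ht
          have := pow_le_pow_left₀ (norm_nonneg z) hz 2
          linarith
        exact (sq_le_sq₀ (norm_nonneg _) hρ.le).1 h2
    have hle : ∀ᶠ t : ℝ in nhdsWithin 0 (Set.Ioi 0), l d + t * B d ≤ 0 := by
      filter_upwards [hfeas, self_mem_nhdsWithin] with t ht ht0
      have ht0 : 0 < t := ht0
      have h1 := hmax _ ht
      rw [hφ, hB, map_smul, smul_eq_mul] at h1
      have h2 : t * (l d + t * B d) ≤ 0 := by nlinarith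
      exact nonpos_of_mul_nonpos_right h2 ht0
    have hc : Filter.Tendsto (fun t : ℝ => l d + t * B d) (nhdsWithin 0 (Set.Ioi 0))
        (nhds (l d + 0 * B d)) :=
      (Continuous.tendsto (by fun_prop) 0).mono_left nhdsWithin_le_nhds
    rw [zero_mul, add_zero] at hc
    exact le_of_tendsto hc hle
  by_cases hlt : ‖z‖ < ρ
  · refine ⟨0, fun d => ?_, fun _ => rfl⟩
    have h1 := hA d (Or.inl hlt)
    have h2 := hA (-d) (Or.inl hlt)
    rw [map_neg] at h2
    linarith
  have hzn : 0 < ‖z‖ := hρ.trans_le (not_lt.1 hlt)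
  -- A tangent direction is the limit of the strictly inward directions `d - t z`.
  have hperp : ∀ d, inner ℝ z d = 0 → l d ≤ 0 := by
    intro d hd
    have hle : ∀ᶠ t : ℝ in nhdsWithin 0 (Set.Ioi 0), l d - t * l z ≤ 0 := by
      filter_upwards [self_mem_nhdsWithin] with t ht0
      have ht0 : 0 < t := ht0
      have := hA (d - t • z) (Or.inr (by
        rw [inner_sub_right, hd, inner_smul_right, real_inner_self_eq_norm_sq]
        have : 0 < t * ‖z‖ ^ 2 := by positivity
        linarith))
      simpa using this
    have hc : Filter.Tendsto (fun t : ℝ => l d - t * l z) (nhdsWithin 0 (Set.Ioi 0))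
        (nhds (l d - 0 * l z)) :=
      (Continuous.tendsto (by fun_prop) 0).mono_left nhdsWithin_le_nhds
    rw [zero_mul, sub_zero] at hc
    exact le_of_tendsto hc hle
  refine ⟨l z / ‖z‖ ^ 2, fun d => ?_, fun h => absurd h hlt⟩
  -- The component of `d` orthogonal to `z`. Since `l` vanishes on it, `l` is determined by its
  -- value at `z`.
  set e := d - (inner ℝ z d / ‖z‖ ^ 2) • z with he
  have hze : inner ℝ z e = 0 := by
    rw [he, inner_sub_right, inner_smul_right, real_inner_self_eq_norm_sq]
    field_simp
    ring
  have h1 := hperp e hze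
  have h2 := hperp (-e) (by rw [inner_neg_right, hze, neg_zero])
  rw [map_neg] at h2
  have h3 : l e = 0 := by linarith
  rw [he, map_sub, map_smul, smul_eq_mul] at h3
  have h4 : l d = inner ℝ z d / ‖z‖ ^ 2 * l z := by linarith
  rw [h4]
  ring

section Separable

variable {d : ℕ} {p σ : Fin d → ℝ}

theorem sum_sq_add_expand (s e : Fin d → ℝ) :
    ∑ i, p i * (σ i + (s i + e i)) ^ 2
      = ∑ i, p i * (σ i + s i) ^ 2 + ∑ i, 2 * p i * (σ i + s i) * e i
        + ∑ i, p i * e i ^ 2 := by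
  rw [← Finset.sum_add_distrib, ← Finset.sum_add_distrib]
  exact Finset.sum_congr rfl fun i _ => by ring

/-- At a maximiser of `∑ pᵢ (σᵢ + sᵢ)² + ψ(m)` on a ball the multiplier exceeds every `pᵢ`. -/
theorem exists_multiplier_gt {ρ : ℝ} (hρ : 0 < ρ) (hp : ∀ i, 0 ≤ p i) (hσ : ∀ i, 0 < σ i)
    (hex : ∃ i, 0 < p i) {ψ : EuclideanSpace ℝ (Fin d) → ℝ} {s m : EuclideanSpace ℝ (Fin d)}
    (hz : ‖s‖ ^ 2 + ‖m‖ ^ 2 ≤ ρ ^ 2)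
    (hmax : ∀ s' m' : EuclideanSpace ℝ (Fin d), ‖s'‖ ^ 2 + ‖m'‖ ^ 2 ≤ ρ ^ 2 →
      ∑ i, p i * (σ i + s' i) ^ 2 + ψ m' ≤ ∑ i, p i * (σ i + s i) ^ 2 + ψ m)
    (l : EuclideanSpace ℝ (Fin d) →ₗ[ℝ] ℝ) (B : EuclideanSpace ℝ (Fin d) → ℝ)
    (hB : ∀ (t : ℝ) e, B (t • e) = t ^ 2 * B e) (hψ : ∀ e, ψ (m + e) = ψ m + l e + B e) :
    ∃ r : ℝ, (∀ i, p i < r) ∧ (∀ i, r * s i = p i * (σ i + s i)) ∧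
      ‖s‖ ^ 2 + ‖m‖ ^ 2 = ρ ^ 2 ∧ ∀ e, l e = 2 * r * inner ℝ m e := by
  -- In the `L²` product the constraint `‖s‖² + ‖m‖² ≤ ρ²` is a single Euclidean ball, so one
  -- multiplier serves both variables.
  set z : WithLp 2 (EuclideanSpace ℝ (Fin d) × EuclideanSpace ℝ (Fin d)) :=
    WithLp.toLp 2 (s, m) with hzdef
  have hnorm : ∀ y : WithLp 2 (EuclideanSpace ℝ (Fin d) × EuclideanSpace ℝ (Fin d)),
      ‖y‖ ^ 2 = ‖y.fst‖ ^ 2 + ‖y.snd‖ ^ 2 := fun y => WithLp.prod_norm_sq_eq_of_L2 y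
  have hball : ∀ y : WithLp 2 (EuclideanSpace ℝ (Fin d) × EuclideanSpace ℝ (Fin d)),
      ‖y‖ ≤ ρ ↔ ‖y.fst‖ ^ 2 + ‖y.snd‖ ^ 2 ≤ ρ ^ 2 := fun y => by
    rw [← hnorm, sq_le_sq₀ (norm_nonneg _) hρ.le]
  let L : WithLp 2 (EuclideanSpace ℝ (Fin d) × EuclideanSpace ℝ (Fin d)) →ₗ[ℝ] ℝ :=
    { toFun := fun y => ∑ i, 2 * p i * (σ i + s i) * y.fst i + l y.snd
      map_add' := fun x y => by
        simp only [WithLp.add_fst, WithLp.add_snd, PiLp.add_apply, map_add, mul_add,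
          Finset.sum_add_distrib]
        ring
      map_smul' := fun c y => by
        simp only [WithLp.smul_fst, WithLp.smul_snd, PiLp.smul_apply, map_smul, smul_eq_mul,
          RingHom.id_apply, mul_add, Finset.mul_sum]
        congr 1
        exact Finset.sum_congr rfl fun i _ => by ring }
  obtain ⟨c, hc, hc0⟩ := exists_multiplier_of_isMax_ball
    (φ := fun y : WithLp 2 (EuclideanSpace ℝ (Fin d) × EuclideanSpace ℝ (Fin d)) =>
      ∑ i, p i * (σ i + y.fst i) ^ 2 + ψ y.snd) (z := z) hρ ((hball z).2 hz)
    (fun y hy => hmax _ _ ((hball y).1 hy)) L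
    (fun y => ∑ i, p i * y.fst i ^ 2 + B y.snd)
    (fun t y => by
      simp only [WithLp.smul_fst, WithLp.smul_snd, PiLp.smul_apply, smul_eq_mul, hB, mul_add,
        Finset.mul_sum]
      congr 1
      exact Finset.sum_congr rfl fun i _ => by ring)
    (fun y => by
      change ∑ i, p i * (σ i + (s i + y.fst i)) ^ 2 + ψ (m + y.snd)
        = ∑ i, p i * (σ i + s i) ^ 2 + ψ m
          + (∑ i, 2 * p i * (σ i + s i) * y.fst i + l y.snd) + _
      rw [hψ, sum_sq_add_expand]
      ring)
  have hs : ∀ i, 2 * p i * (σ i + s i) = c * s i := fun i => by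
    have h := hc (WithLp.toLp 2 (EuclideanSpace.single i 1, 0))
    simpa [L, hzdef, WithLp.prod_inner_apply, EuclideanSpace.inner_single_right,
      PiLp.single_apply] using h
  have hm : ∀ e, l e = c * inner ℝ m e := fun e => by
    have h := hc (WithLp.toLp 2 (0, e))
    simpa [L, hzdef, WithLp.prod_inner_apply] using h
  -- Replacing `s` by its coordinatewise absolute value keeps the norm and, since `σ > 0`, would
  -- strictly increase the objective if `s i < 0` for some `i` with `p i > 0`.
  have hnonneg : ∀ i, 0 < p i → 0 ≤ s i := by
    intro i hi
    by_contra hneg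
    push Not at hneg
    set s' : EuclideanSpace ℝ (Fin d) := WithLp.toLp 2 fun j => |s j| with hs'
    have hn : ‖s'‖ ^ 2 = ‖s‖ ^ 2 := by
      rw [EuclideanSpace.real_norm_sq_eq, EuclideanSpace.real_norm_sq_eq]
      exact Finset.sum_congr rfl fun j _ => sq_abs _
    have h1 := hmax s' m (by rw [hn]; exact hz)
    have h2 : ∑ j, p j * (σ j + s j) ^ 2 < ∑ j, p j * (σ j + s' j) ^ 2 := by
      refine Finset.sum_lt_sum (fun j _ => ?_) ⟨i, Finset.mem_univ _, ?_⟩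
      · refine mul_le_mul_of_nonneg_left ?_ (hp j)
        change _ ≤ (σ j + |s j|) ^ 2
        have := sq_abs (s j)
        nlinarith [le_abs_self (s j), hσ j]
      · refine mul_lt_mul_of_pos_left ?_ hi
        change _ < (σ i + |s i|) ^ 2
        rw [abs_of_neg hneg]
        nlinarith [hσ i]
    linarith
  -- Stationarity gives `c sᵢ = 2 pᵢ (σᵢ + sᵢ) > 0`, hence `sᵢ > 0` and `c > 0`; then `(c / 2 - pᵢ)
  -- sᵢ = pᵢ σᵢ > 0`.
  have hpos : ∀ i, 0 < p i → 0 < c ∧ p i < c / 2 := by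
    intro i hi
    have h1 := hs i
    have h2 : 0 < p i * σ i := mul_pos hi (hσ i)
    have h3 : 0 ≤ p i * s i := mul_nonneg hi.le (hnonneg i hi)
    have h4 : 0 < c * s i := by nlinarith
    have h5 : 0 < s i := lt_of_le_of_ne (hnonneg i hi) fun h => by
      rw [← h, mul_zero] at h4
      exact lt_irrefl _ h4
    refine ⟨pos_of_mul_pos_left h4 h5.le, ?_⟩
    have h6 : 0 < (c / 2 - p i) * s i := by nlinarith
    linarith [pos_of_mul_pos_left h6 h5.le]
  obtain ⟨i₀, hi₀⟩ := hex
  have hcpos := (hpos i₀ hi₀).1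
  refine ⟨c / 2, fun i => ?_, fun i => ?_, ?_, fun e => ?_⟩
  · rcases (hp i).eq_or_lt with h | h
    · rw [← h]
      linarith
    · exact (hpos i h).2
  · linarith [hs i]
  -- Complementary slackness: a nonzero multiplier forces the constraint to be active.
  · have : ¬ ‖z‖ < ρ := fun h => hcpos.ne' (hc0 h)
    have h2 : ‖z‖ = ρ := le_antisymm ((hball z).2 hz) (not_lt.1 this)
    have h3 := hnorm z
    rw [h2] at h3
    exact h3.symm
  · rw [hm]
    ring

end Separable

/-! ### Moments under affine maps -/

section Moments

variable {d : ℕ} {μ : Measure (EuclideanSpace ℝ (Fin d))} {a : EuclideanSpace ℝ (Fin d)}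
  {V : Matrix (Fin d) (Fin d) ℝ}

/-- The affine map `x ↦ M x + c`. -/
noncomputable def affineMap (M : Matrix (Fin d) (Fin d) ℝ) (c x : EuclideanSpace ℝ (Fin d)) :
    EuclideanSpace ℝ (Fin d) :=
  WithLp.toLp 2 (M *ᵥ x.ofLp) + c

theorem affineMap_eq (M : Matrix (Fin d) (Fin d) ℝ) (c : EuclideanSpace ℝ (Fin d)) :
    affineMap M c = (fun x => x + c) ∘ (Matrix.toEuclideanCLM (𝕜 := ℝ) M) := by
  funext x
  rfl

theorem continuous_affineMap (M : Matrix (Fin d) (Fin d) ℝ) (c : EuclideanSpace ℝ (Fin d)) :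
    Continuous (affineMap M c) := by
  rw [affineMap_eq]
  fun_prop

theorem isGaussian_map_affineMap [IsGaussian μ] (M : Matrix (Fin d) (Fin d) ℝ)
    (c : EuclideanSpace ℝ (Fin d)) : IsGaussian (μ.map (affineMap M c)) := by
  rw [affineMap_eq, ← Measure.map_map (by fun_prop) (by fun_prop)]
  infer_instance

variable [IsProbabilityMeasure μ]

theorem HasMeanCov.integral_apply (h : HasMeanCov μ a V) (i : Fin d) : ∫ x, x i ∂μ = a i := by
  rw [← h.mean_eq]
  exact integral_apply_of_memLp (X := fun x => x) h.memLp i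

theorem HasMeanCov.integrable_apply (h : HasMeanCov μ a V) (i : Fin d) :
    Integrable (fun x : EuclideanSpace ℝ (Fin d) => x i) μ :=
  (h.memLp.eval_piLp i).integrable one_le_two

omit [IsProbabilityMeasure μ] in
theorem HasMeanCov.integrable_mul (h : HasMeanCov μ a V) (i j : Fin d) :
    Integrable (fun x : EuclideanSpace ℝ (Fin d) => x i * x j) μ :=
  (h.memLp.eval_piLp i).integrable_mul (h.memLp.eval_piLp j)

theorem HasMeanCov.integral_mul (h : HasMeanCov μ a V) (i j : Fin d) :
    ∫ x, x i * x j ∂μ = V i j + a i * a j := by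
  rw [← h.cov_eq i j]
  have e : ∀ x : EuclideanSpace ℝ (Fin d), (x i - a i) * (x j - a j)
      = x i * x j - a j * x i - a i * x j + a i * a j := fun x => by ring
  simp_rw [e]
  have i1 := h.integrable_mul i j
  have i2 := (h.integrable_apply i).const_mul (a j)
  have i3 := (h.integrable_apply j).const_mul (a i)
  have i12 := i1.sub i2
  have i123 := i12.sub i3
  have : ∫ x : EuclideanSpace ℝ (Fin d), x i * x j - a j * x i - a i * x j + a i * a j ∂μ
      = ∫ x : EuclideanSpace ℝ (Fin d), x i * x j ∂μ - ∫ x, a j * x i ∂μ - ∫ x, a i * x j ∂μ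
        + ∫ x, a i * a j ∂μ := by
    rw [← integral_sub' i1 i2, ← integral_sub' i12 i3, ← integral_add' i123 (integrable_const _)]
    rfl
  rw [this, integral_const_mul, integral_const_mul, h.integral_apply, h.integral_apply]
  simp
  ring

/-- The expectation of a quadratic form. -/
theorem HasMeanCov.integral_quadratic (h : HasMeanCov μ a V) (P : Matrix (Fin d) (Fin d) ℝ) :
    ∫ x, x.ofLp ⬝ᵥ (P *ᵥ x.ofLp) ∂μ = (V * Pᵀ).trace + a.ofLp ⬝ᵥ (P *ᵥ a.ofLp) := by
  have hint : ∀ i j, Integrable (fun x : EuclideanSpace ℝ (Fin d) => x i * (P i j * x j)) μ :=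
    fun i j => ((h.integrable_mul i j).const_mul (P i j)).congr (ae_of_all _ fun x => by ring)
  simp only [dotProduct, mulVec, Finset.mul_sum, Matrix.trace, Matrix.diag, Matrix.mul_apply,
    Matrix.transpose_apply]
  rw [integral_finsetSum _ fun i _ => integrable_finsetSum _ fun j _ => hint i j,
    ← Finset.sum_add_distrib]
  refine Finset.sum_congr rfl fun i _ => ?_
  rw [integral_finsetSum _ fun j _ => hint i j, ← Finset.sum_add_distrib]
  refine Finset.sum_congr rfl fun j _ => ?_
  have e : ∀ x : EuclideanSpace ℝ (Fin d), x i * (P i j * x j) = P i j * (x i * x j) :=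
    fun x => by ring
  simp_rw [e]
  rw [integral_const_mul, h.integral_mul]
  ring

theorem MemLp.affineMap_comp {Ω : Type*} [MeasurableSpace Ω] {P : Measure Ω} [IsFiniteMeasure P]
    {X : Ω → EuclideanSpace ℝ (Fin d)} (hX : MemLp X 2 P) (M : Matrix (Fin d) (Fin d) ℝ)
    (c : EuclideanSpace ℝ (Fin d)) : MemLp (fun ω => affineMap M c (X ω)) 2 P := by
  rw [affineMap_eq]
  exact ((Matrix.toEuclideanCLM (𝕜 := ℝ) M).comp_memLp' hX).add (memLp_const c)

theorem HasMeanCov.map_affineMap (h : HasMeanCov μ 0 V) (M : Matrix (Fin d) (Fin d) ℝ)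
    (c : EuclideanSpace ℝ (Fin d)) : HasMeanCov (μ.map (affineMap M c)) c (M * V * Mᵀ) := by
  have hm : AEMeasurable (affineMap M c) μ := (continuous_affineMap M c).measurable.aemeasurable
  refine ⟨?_, ?_, fun i j => ?_⟩
  · rw [memLp_map_measure_iff (by fun_prop) hm]
    exact MemLp.affineMap_comp h.memLp M c
  · rw [integral_map hm (by fun_prop), affineMap_eq]
    have hi : Integrable (fun x : EuclideanSpace ℝ (Fin d) => x) μ := h.memLp.integrable one_le_two
    have := (Matrix.toEuclideanCLM (𝕜 := ℝ) M).integral_comp_comm hi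
    simp only [Function.comp_apply]
    rw [integral_add ((Matrix.toEuclideanCLM (𝕜 := ℝ) M).integrable_comp hi)
      (integrable_const _), this, h.mean_eq]
    simp
  · rw [integral_map hm (by fun_prop)]
    have e : ∀ x : EuclideanSpace ℝ (Fin d), (affineMap M c x i - c i) * (affineMap M c x j - c j)
        = ∑ k, ∑ l, M i k * M j l * (x k * x l) := fun x => by
      simp only [affineMap, PiLp.add_apply, add_sub_cancel_right, mulVec, dotProduct,
        Finset.sum_mul_sum]
      exact Finset.sum_congr rfl fun k _ => Finset.sum_congr rfl fun l _ => by ring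
    simp_rw [e]
    rw [integral_finsetSum _ fun k _ => integrable_finsetSum _ fun l _ =>
      (h.integrable_mul k l).const_mul _]
    simp only [Matrix.mul_apply, Matrix.transpose_apply, Finset.sum_mul]
    rw [Finset.sum_comm]
    refine Finset.sum_congr rfl fun k _ => ?_
    rw [integral_finsetSum _ fun l _ => (h.integrable_mul k l).const_mul _]
    refine Finset.sum_congr rfl fun l _ => ?_
    rw [integral_const_mul, h.integral_mul]
    simp
    ring

end Moments

/-! ### One-dimensional comparison -/

section OneDim

variable {Ω : Type*} [MeasurableSpace Ω] {P : Measure Ω} [IsProbabilityMeasure P]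

omit [IsProbabilityMeasure P] in
theorem integral_add₃ {f₀ f₁ f₂ : Ω → ℝ} (h₀ : Integrable f₀ P) (h₁ : Integrable f₁ P)
    (h₂ : Integrable f₂ P) :
    ∫ ω, f₀ ω + f₁ ω + f₂ ω ∂P = ∫ ω, f₀ ω ∂P + ∫ ω, f₁ ω ∂P + ∫ ω, f₂ ω ∂P := by
  rw [← integral_add' h₀ h₁, ← integral_add' (h₀.add h₁) h₂]
  rfl

omit [IsProbabilityMeasure P] in
/-- The Cauchy–Schwarz inequality for expectations. -/
theorem integral_mul_le_of_sq {f g : Ω → ℝ} {s σ : ℝ} (hf : MemLp f 2 P) (hg : MemLp g 2 P)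
    (hs : 0 ≤ s) (hσ : 0 ≤ σ) (hf2 : ∫ ω, f ω ^ 2 ∂P = σ ^ 2) (hg2 : ∫ ω, g ω ^ 2 ∂P = s ^ 2) :
    ∫ ω, f ω * g ω ∂P ≤ σ * s := by
  have i1 := hf.integrable_sq
  have i2 := hg.integrable_sq
  have i3 : Integrable (fun ω => f ω * g ω) P := hf.integrable_mul hg
  -- The second moment of `t f + g` is a nonnegative quadratic in `t`, so its discriminant is
  -- nonpositive.
  have key : ∀ t : ℝ, 0 ≤ σ ^ 2 * (t * t) + 2 * (∫ ω, f ω * g ω ∂P) * t + s ^ 2 := by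
    intro t
    have h0 : 0 ≤ ∫ ω, (t * f ω + g ω) ^ 2 ∂P := integral_nonneg fun ω => sq_nonneg _
    have e : ∀ ω, (t * f ω + g ω) ^ 2 = (t * t) * f ω ^ 2 + (2 * t) * (f ω * g ω) + g ω ^ 2 :=
      fun ω => by ring
    simp_rw [e] at h0
    rw [integral_add₃ (i1.const_mul _) (i3.const_mul _) i2, integral_const_mul, integral_const_mul,
      hf2, hg2] at h0
    linarith
  have hd := discrim_le_zero key
  rw [discrim] at hd
  have h2 : (∫ ω, f ω * g ω ∂P) ^ 2 ≤ (σ * s) ^ 2 := by nlinarith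
  exact le_of_sq_le_sq h2 (mul_nonneg hσ hs)

/-- Comparison of second moments of two coupled random variables. -/
theorem exists_integral_sq_le {X Y : Ω → ℝ} {a σ : ℝ} (hX : MemLp X 2 P) (hY : MemLp Y 2 P)
    (hσ : 0 ≤ σ) (hXa : ∫ ω, X ω ∂P = a) (hY0 : ∫ ω, Y ω ∂P = 0)
    (hY2 : ∫ ω, Y ω ^ 2 ∂P = σ ^ 2) :
    ∃ s : ℝ, s ^ 2 + a ^ 2 = ∫ ω, (X ω - Y ω) ^ 2 ∂P ∧
      ∫ ω, X ω ^ 2 ∂P ≤ (σ + s) ^ 2 + a ^ 2 := by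
  -- The centred displacement; `s` is its `L²` norm. In `X = Y + g + a` the part `Y + g` is centred,
  -- so the only term of `E X²` left to bound is `E[Y g]`.
  let g : Ω → ℝ := fun ω => X ω - Y ω - a
  have hgL : MemLp g 2 P := (hX.sub hY).sub (memLp_const a)
  have iX := hX.integrable one_le_two
  have iY := hY.integrable one_le_two
  have ig := hgL.integrable one_le_two
  have hg0 : ∫ ω, g ω ∂P = 0 := by
    have h1 : ∫ ω, g ω ∂P = ∫ ω, X ω ∂P - ∫ ω, Y ω ∂P - ∫ _, a ∂P := by
      rw [← integral_sub' iX iY, ← integral_sub' (iX.sub iY) (integrable_const a)]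
      rfl
    rw [h1, hXa, hY0]
    simp
  have hgnn : 0 ≤ ∫ ω, g ω ^ 2 ∂P := integral_nonneg fun ω => sq_nonneg _
  refine ⟨Real.sqrt (∫ ω, g ω ^ 2 ∂P), ?_, ?_⟩
  · rw [Real.sq_sqrt hgnn]
    have e : ∀ ω, (X ω - Y ω) ^ 2 = g ω ^ 2 + (2 * a) * g ω + a ^ 2 := fun ω => by
      simp only [g]
      ring
    simp_rw [e]
    rw [integral_add₃ hgL.integrable_sq (ig.const_mul _) (integrable_const _),
      integral_const_mul, hg0]
    simp
  · have hcs := integral_mul_le_of_sq hY hgL (Real.sqrt_nonneg _) hσ hY2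
      (Real.sq_sqrt hgnn).symm
    have iYg : Integrable (fun ω => Y ω * g ω) P := hY.integrable_mul hgL
    have e : ∀ ω, X ω ^ 2 = Y ω ^ 2 + 2 * (Y ω * g ω) + g ω ^ 2 + (2 * a) * (Y ω + g ω)
        + a ^ 2 := fun ω => by
      simp only [g]
      ring
    have iYg' : Integrable (fun ω => (2 * a) * (Y ω + g ω)) P := (iY.add ig).const_mul (2 * a)
    have hX2 : ∫ ω, X ω ^ 2 ∂P = σ ^ 2 + 2 * ∫ ω, Y ω * g ω ∂P + ∫ ω, g ω ^ 2 ∂P + a ^ 2 := by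
      simp_rw [e]
      rw [integral_add₃ (f₀ := fun ω => Y ω ^ 2 + 2 * (Y ω * g ω) + g ω ^ 2)
        ((hY.integrable_sq.add (iYg.const_mul 2)).add hgL.integrable_sq) iYg'
        (integrable_const _), integral_add₃ hY.integrable_sq (iYg.const_mul 2) hgL.integrable_sq,
        integral_const_mul, integral_const_mul, integral_add iY ig, hY0, hg0, hY2]
      simp
    rw [hX2]
    have := Real.sq_sqrt hgnn
    nlinarith

end OneDim

/-! ### Spectral calculus of a positive semidefinite matrix -/

section Spectral

variable {d : ℕ}

/-- The spectral theorem with a real orthogonal `W`, which turns every matrix function of `P` below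
into a computation with diagonals. -/
theorem Matrix.PosSemidef.exists_spectral {P : Matrix (Fin d) (Fin d) ℝ} (hP : P.PosSemidef) :
    ∃ (W : Matrix (Fin d) (Fin d) ℝ) (p : Fin d → ℝ), Wᵀ * W = 1 ∧ W * Wᵀ = 1 ∧
      P = W * diagonal p * Wᵀ ∧ (∀ i, 0 ≤ p i) ∧ ∀ e ∈ spectrum ℝ P, ∃ i, e = p i := by
  have h := hP.isHermitian
  refine ⟨h.eigenvectorUnitary, h.eigenvalues, ?_, ?_, ?_, hP.eigenvalues_nonneg, ?_⟩
  · have := Unitary.coe_star_mul_self h.eigenvectorUnitary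
    simpa [star_eq_conjTranspose, conjTranspose_eq_transpose_of_trivial] using this
  · have := Unitary.coe_mul_star_self h.eigenvectorUnitary
    simpa [star_eq_conjTranspose, conjTranspose_eq_transpose_of_trivial] using this
  · have := h.spectral_theorem
    rw [Unitary.conjStarAlgAut_apply] at this
    simpa [star_eq_conjTranspose, conjTranspose_eq_transpose_of_trivial] using this
  · intro e he
    rw [h.spectrum_real_eq_range_eigenvalues] at he
    obtain ⟨i, hi⟩ := he
    exact ⟨i, hi.symm⟩

variable {W : Matrix (Fin d) (Fin d) ℝ}

theorem conj_diagonal_mul (hW : Wᵀ * W = 1) (f g : Fin d → ℝ) :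
    (W * diagonal f * Wᵀ) * (W * diagonal g * Wᵀ) = W * diagonal (fun i => f i * g i) * Wᵀ := by
  rw [← diagonal_mul_diagonal]
  calc _ = W * diagonal f * (Wᵀ * W) * diagonal g * Wᵀ := by simp only [Matrix.mul_assoc]
    _ = _ := by rw [hW, Matrix.mul_one]; simp only [Matrix.mul_assoc]

theorem conj_diagonal_const (hW' : W * Wᵀ = 1) (c : ℝ) :
    W * diagonal (fun _ => c) * Wᵀ = c • (1 : Matrix (Fin d) (Fin d) ℝ) := by
  rw [show (diagonal fun _ : Fin d => c) = c • (1 : Matrix (Fin d) (Fin d) ℝ) by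
    rw [smul_one_eq_diagonal], Matrix.mul_smul, Matrix.mul_one, Matrix.smul_mul, hW']

theorem conj_diagonal_sub (f g : Fin d → ℝ) :
    W * diagonal f * Wᵀ - W * diagonal g * Wᵀ = W * diagonal (fun i => f i - g i) * Wᵀ := by
  rw [← diagonal_sub, Matrix.mul_sub, Matrix.sub_mul]

theorem conj_diagonal_smul (c : ℝ) (f : Fin d → ℝ) :
    c • (W * diagonal f * Wᵀ) = W * diagonal (fun i => c * f i) * Wᵀ := by
  rw [show (diagonal fun i => c * f i) = c • diagonal f by rw [← diagonal_smul]; rfl,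
    Matrix.mul_smul, Matrix.smul_mul]

theorem conj_diagonal_inv (hW : Wᵀ * W = 1) (hW' : W * Wᵀ = 1) {f : Fin d → ℝ}
    (hf : ∀ i, f i ≠ 0) :
    (W * diagonal f * Wᵀ)⁻¹ = W * diagonal (fun i => (f i)⁻¹) * Wᵀ := by
  refine Matrix.inv_eq_right_inv ?_
  rw [conj_diagonal_mul hW, show (fun i => f i * (f i)⁻¹) = fun _ => (1 : ℝ) from
    funext fun i => mul_inv_cancel₀ (hf i), conj_diagonal_const hW', one_smul]

theorem conj_diagonal_transpose (f : Fin d → ℝ) :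
    (W * diagonal f * Wᵀ)ᵀ = W * diagonal f * Wᵀ := by
  simp only [transpose_mul, transpose_transpose, diagonal_transpose, Matrix.mul_assoc]

theorem eq_zero_of_conj_diagonal_eq_zero (hW : Wᵀ * W = 1) {f : Fin d → ℝ}
    (h : W * diagonal f * Wᵀ = 0) (i : Fin d) : f i = 0 := by
  have h1 : diagonal f = Wᵀ * (W * diagonal f * Wᵀ) * W := by
    calc diagonal f = (Wᵀ * W) * diagonal f * (Wᵀ * W) := by
          rw [hW, Matrix.one_mul, Matrix.mul_one]
      _ = _ := by simp only [Matrix.mul_assoc]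
  rw [h, Matrix.mul_zero, Matrix.zero_mul] at h1
  exact congrFun (diagonal_eq_zero.1 h1) i

/-- Only the diagonal of `V` in the eigenbasis of `P` enters the traces; its entries are the
variances `σ i ^ 2`. -/
theorem trace_mul_conj_diagonal (V : Matrix (Fin d) (Fin d) ℝ) (f : Fin d → ℝ) :
    (V * (W * diagonal f * Wᵀ)).trace = ∑ i, (Wᵀ * V * W) i i * f i := by
  rw [← Matrix.mul_assoc, Matrix.trace_mul_comm]
  simp only [← Matrix.mul_assoc]
  simp [Matrix.trace, Matrix.mul_diagonal]

theorem dotProduct_conj_diagonal (f : Fin d → ℝ) (x : Fin d → ℝ) :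
    x ⬝ᵥ ((W * diagonal f * Wᵀ) *ᵥ x) = ∑ i, f i * (Wᵀ *ᵥ x) i ^ 2 := by
  rw [← mulVec_mulVec, ← mulVec_mulVec, dotProduct_mulVec, ← mulVec_transpose]
  simp only [dotProduct, mulVec_diagonal]
  exact Finset.sum_congr rfl fun i _ => by ring

theorem sum_sq_transpose_mulVec (hW' : W * Wᵀ = 1) (x : Fin d → ℝ) :
    ∑ i, (Wᵀ *ᵥ x) i ^ 2 = ∑ i, x i ^ 2 := by
  have h := dotProduct_conj_diagonal (W := W) (fun _ => 1) x
  rw [conj_diagonal_const hW', one_smul, one_mulVec] at h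
  simp only [one_mul] at h
  rw [← h, dotProduct]
  exact Finset.sum_congr rfl fun i _ => by ring

/-- This makes the `σ i` strictly positive, and is the only use of positive definiteness of the
reference covariances. -/
theorem conj_diag_pos (hW' : W * Wᵀ = 1) {V : Matrix (Fin d) (Fin d) ℝ} (hV : V.PosDef)
    (i : Fin d) : 0 < (Wᵀ * V * W) i i := by
  have hinj : Function.Injective W.mulVec := by
    rw [Matrix.mulVec_injective_iff_isUnit]
    exact IsUnit.of_mul_eq_one _ hW'
  have h := hV.conjTranspose_mul_mul_same hinj
  rw [conjTranspose_eq_transpose_of_trivial] at h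
  exact h.diag_pos

end Spectral

/-! ### Second moments over Wasserstein balls -/

section Wasserstein

variable {d : ℕ} {μ μref : Measure (EuclideanSpace ℝ (Fin d))} {V : Matrix (Fin d) (Fin d) ℝ}

theorem lintegral_enorm_sq_eq {Ω : Type*} [MeasurableSpace Ω] {P : Measure Ω}
    {X : Ω → EuclideanSpace ℝ (Fin d)} (hX : MemLp X 2 P) :
    ∫⁻ ω, ‖X ω‖ₑ ^ 2 ∂P = ENNReal.ofReal (∫ ω, ‖X ω‖ ^ 2 ∂P) := by
  rw [ofReal_integral_eq_lintegral_ofReal (hX.integrable_norm_pow two_ne_zero)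
    (ae_of_all _ fun ω => by positivity)]
  refine lintegral_congr fun ω => ?_
  rw [ENNReal.ofReal_pow (norm_nonneg _), ofReal_norm]

/-- The infimum over couplings is not shown to be attained, so a slack `ε` in the transport cost is
allowed here and removed afterwards by compactness. -/
theorem exists_coupling_lt {ρ ε : ℝ} (hρ : 0 ≤ ρ) (hε : 0 < ε) (h : μ ∈ ambiguitySet ρ μref) :
    ∃ γ ∈ couplings μ μref, ∫⁻ z, ‖z.1 - z.2‖ₑ ^ 2 ∂γ < ENNReal.ofReal (ρ ^ 2 + ε) := by
  have h1 := h.2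
  rw [wasserstein2] at h1
  have h2 : (⨅ γ ∈ couplings μ μref, ∫⁻ z, ‖z.1 - z.2‖ₑ ^ 2 ∂γ) ≤ ENNReal.ofReal (ρ ^ 2) := by
    have h3 := ENNReal.rpow_le_rpow h1 (by norm_num : (0 : ℝ) ≤ 2)
    rw [← ENNReal.rpow_mul] at h3
    norm_num at h3
    rwa [ENNReal.ofReal_pow hρ]
  have h4 := h2.trans_lt ((ENNReal.ofReal_lt_ofReal_iff (by positivity)).2
    (by linarith : ρ ^ 2 < ρ ^ 2 + ε))
  simpa [iInf_lt_iff] using h4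

theorem measurePreserving_fst_of_coupling {γ : Measure (EuclideanSpace ℝ (Fin d) ×
    EuclideanSpace ℝ (Fin d))} (hγ : γ ∈ couplings μ μref) :
    MeasurePreserving Prod.fst γ μ := ⟨measurable_fst, hγ.2.1⟩

theorem measurePreserving_snd_of_coupling {γ : Measure (EuclideanSpace ℝ (Fin d) ×
    EuclideanSpace ℝ (Fin d))} (hγ : γ ∈ couplings μ μref) :
    MeasurePreserving Prod.snd γ μref := ⟨measurable_snd, hγ.2.2⟩

theorem memLp_sub_of_lintegral_lt {Ω : Type*} [MeasurableSpace Ω] {P : Measure Ω}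
    {X : Ω → EuclideanSpace ℝ (Fin d)} (hX : AEStronglyMeasurable X P)
    (h : ∫⁻ ω, ‖X ω‖ₑ ^ 2 ∂P < ∞) : MemLp X 2 P := by
  refine ⟨hX, ?_⟩
  rw [eLpNorm_lt_top_iff_lintegral_rpow_enorm_lt_top two_ne_zero ENNReal.ofNat_ne_top]
  simpa using h

/-- Under a coupling of finite cost, `x = (x - y) + y` is a sum of two square-integrable variables.
-/
theorem memLp_of_mem_ambiguitySet {ρ : ℝ} (hρ : 0 ≤ ρ) (href : MemLp id 2 μref)
    (h : μ ∈ ambiguitySet ρ μref) : MemLp id 2 μ := by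
  obtain ⟨γ, hγ, hlt⟩ := exists_coupling_lt hρ one_pos h
  have h1 : MemLp (fun z : EuclideanSpace ℝ (Fin d) × EuclideanSpace ℝ (Fin d) => z.1 - z.2)
      2 γ := memLp_sub_of_lintegral_lt (by fun_prop) (hlt.trans ENNReal.ofReal_lt_top)
  have h2 := href.comp_measurePreserving (measurePreserving_snd_of_coupling hγ)
  have h3 : MemLp (Prod.fst : EuclideanSpace ℝ (Fin d) × EuclideanSpace ℝ (Fin d) → _) 2 γ := by
    refine (h1.add h2).congr_norm (by fun_prop) (ae_of_all _ fun z => ?_)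
    simp
  rw [← hγ.2.1, memLp_map_measure_iff (by fun_prop) (by fun_prop)]
  exact h3

/-- The second moments of a distribution coupled to the reference are bounded as if the
coupling acted diagonally in the eigenbasis. -/
theorem exists_bound_of_coupling [IsProbabilityMeasure μref] (href : HasMeanCov μref 0 V)
    {W : Matrix (Fin d) (Fin d) ℝ} {p σ : Fin d → ℝ} (hW' : W * Wᵀ = 1) (hp : ∀ i, 0 ≤ p i)
    (hσ : ∀ i, 0 ≤ σ i) (hσV : ∀ i, σ i ^ 2 = (Wᵀ * V * W) i i) (hμ : MemLp id 2 μ)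
    {γ : Measure (EuclideanSpace ℝ (Fin d) × EuclideanSpace ℝ (Fin d))}
    (hγ : γ ∈ couplings μ μref) {r : ℝ} (hr : 0 ≤ r)
    (hlt : ∫⁻ z, ‖z.1 - z.2‖ₑ ^ 2 ∂γ ≤ ENNReal.ofReal r) :
    ∃ s : EuclideanSpace ℝ (Fin d), ‖s‖ ^ 2 + ‖∫ x, x ∂μ‖ ^ 2 ≤ r ∧
      ∫ x, x.ofLp ⬝ᵥ ((W * diagonal p * Wᵀ) *ᵥ x.ofLp) ∂μ ≤ ∑ i, p i * (σ i + s i) ^ 2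
        + (∫ x, x ∂μ).ofLp ⬝ᵥ ((W * diagonal p * Wᵀ) *ᵥ (∫ x, x ∂μ).ofLp) := by
  have hγp : IsProbabilityMeasure γ := hγ.1
  have m1 := measurePreserving_fst_of_coupling hγ
  have m2 := measurePreserving_snd_of_coupling hγ
  have hX0 : MemLp (fun z : EuclideanSpace ℝ (Fin d) × EuclideanSpace ℝ (Fin d) => z.1) 2 γ :=
    hμ.comp_measurePreserving m1
  have hY0 : MemLp (fun z : EuclideanSpace ℝ (Fin d) × EuclideanSpace ℝ (Fin d) => z.2) 2 γ :=
    href.memLp.comp_measurePreserving m2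
  -- Both variables are passed to eigencoordinates `Wᵀ x`, viewed as affine images with zero offset.
  have hX := fun i => (MemLp.affineMap_comp hX0 Wᵀ 0).eval_piLp i
  have hY := fun i => (MemLp.affineMap_comp hY0 Wᵀ 0).eval_piLp i
  have haff : ∀ (x : EuclideanSpace ℝ (Fin d)) i, affineMap Wᵀ 0 x i = (Wᵀ *ᵥ x.ofLp) i := by
    intro x i
    simp [affineMap]
  simp only [haff] at hX hY
  set a := ∫ x, x ∂μ with ha
  have hXa : ∀ i, ∫ z, (Wᵀ *ᵥ z.1.ofLp) i ∂γ = (Wᵀ *ᵥ a.ofLp) i := fun i => by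
    have h1 := integral_dotProduct hX0 (Wᵀ i)
    have h2 : ∫ z, z.1 ∂γ = a := by
      rw [ha, ← hγ.2.1, integral_map (by fun_prop) (by fun_prop)]
    rw [h2] at h1
    exact h1
  have hYa : ∀ i, ∫ z, (Wᵀ *ᵥ z.2.ofLp) i ∂γ = 0 := fun i => by
    have h1 := integral_dotProduct hY0 (Wᵀ i)
    have h2 : ∫ z, z.2 ∂γ = 0 := by
      rw [← href.mean_eq, ← hγ.2.2, integral_map (by fun_prop) (by fun_prop)]
    rw [h2] at h1
    rw [show (∫ z, (Wᵀ *ᵥ z.2.ofLp) i ∂γ) = ∫ z, Wᵀ i ⬝ᵥ z.2.ofLp ∂γ from rfl, h1]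
    simp
  have hYs : ∀ i, ∫ z, (Wᵀ *ᵥ z.2.ofLp) i ^ 2 ∂γ = σ i ^ 2 := fun i => by
    have hA := (continuous_affineMap Wᵀ 0).measurable.aemeasurable (μ := μref)
    have hprob : IsProbabilityMeasure (μref.map (affineMap Wᵀ 0)) :=
      Measure.isProbabilityMeasure_map hA
    have h1 := (href.map_affineMap Wᵀ 0).integral_mul i i
    rw [integral_map hA (by fun_prop), ← hγ.2.2, integral_map (by fun_prop)
      (Continuous.aestronglyMeasurable (by
        have := continuous_affineMap (d := d) Wᵀ 0
        fun_prop))] at h1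
    simp only [haff, transpose_transpose] at h1
    rw [hσV, ← add_zero ((Wᵀ * V * W) i i)]
    simpa [sq] using h1
  -- The scalar comparison in each eigencoordinate. Orthogonality of `W` makes the coordinatewise
  -- transport costs add up to the full one.
  choose s hs1 hs2 using fun i => exists_integral_sq_le (hX i) (hY i) (hσ i) (hXa i) (hYa i) (hYs i)
  refine ⟨WithLp.toLp 2 s, ?_, ?_⟩
  · have hD : MemLp (fun z : EuclideanSpace ℝ (Fin d) × EuclideanSpace ℝ (Fin d) => z.1 - z.2)
      2 γ := hX0.sub hY0
    rw [lintegral_enorm_sq_eq hD, ENNReal.ofReal_le_ofReal_iff hr] at hlt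
    refine le_trans (le_of_eq ?_) hlt
    rw [EuclideanSpace.real_norm_sq_eq, EuclideanSpace.real_norm_sq_eq,
      ← sum_sq_transpose_mulVec hW' a.ofLp, ← Finset.sum_add_distrib]
    simp only [hs1]
    rw [← integral_finsetSum (f := fun i (z : EuclideanSpace ℝ (Fin d) × EuclideanSpace ℝ (Fin d)) =>
      ((Wᵀ *ᵥ z.1.ofLp) i - (Wᵀ *ᵥ z.2.ofLp) i) ^ 2) _
      fun i _ => ((hX i).sub (hY i)).integrable_sq]
    refine integral_congr_ae (ae_of_all _ fun z => ?_)
    simp only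
    rw [EuclideanSpace.real_norm_sq_eq, ← sum_sq_transpose_mulVec hW' (z.1 - z.2).ofLp]
    simp [mulVec_sub]
  · have hq : ∫ x, x.ofLp ⬝ᵥ ((W * diagonal p * Wᵀ) *ᵥ x.ofLp) ∂μ
        = ∑ i, p i * ∫ z, (Wᵀ *ᵥ z.1.ofLp) i ^ 2 ∂γ := by
      have hc : Continuous fun x : EuclideanSpace ℝ (Fin d) =>
          x.ofLp ⬝ᵥ ((W * diagonal p * Wᵀ) *ᵥ x.ofLp) := by
        simp only [dotProduct, mulVec]
        fun_prop
      rw [← hγ.2.1, integral_map (by fun_prop) hc.aestronglyMeasurable]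
      simp only [dotProduct_conj_diagonal]
      rw [integral_finsetSum _ fun i _ => (hX i).integrable_sq.const_mul (p i)]
      exact Finset.sum_congr rfl fun i _ => integral_const_mul _ _
    rw [hq, dotProduct_conj_diagonal, ← Finset.sum_add_distrib]
    refine Finset.sum_le_sum fun i _ => ?_
    rw [← mul_add]
    exact mul_le_mul_of_nonneg_left (hs2 i) (hp i)

/-- Couplings yield a suitable `s` for every radius `ρ² + ε`; since the condition on `s` is closed
and `s` stays in a fixed compact ball, one exists for `ε = 0`. -/
theorem exists_bound_of_mem_ambiguitySet [IsProbabilityMeasure μref] (href : HasMeanCov μref 0 V)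
    {W : Matrix (Fin d) (Fin d) ℝ} {p σ : Fin d → ℝ} (hW' : W * Wᵀ = 1) (hp : ∀ i, 0 ≤ p i)
    (hσ : ∀ i, 0 ≤ σ i) (hσV : ∀ i, σ i ^ 2 = (Wᵀ * V * W) i i) {ρ : ℝ} (hρ : 0 ≤ ρ)
    (hμ : μ ∈ ambiguitySet ρ μref) :
    ∃ s : EuclideanSpace ℝ (Fin d), ‖s‖ ^ 2 + ‖∫ x, x ∂μ‖ ^ 2 ≤ ρ ^ 2 ∧
      ∫ x, x.ofLp ⬝ᵥ ((W * diagonal p * Wᵀ) *ᵥ x.ofLp) ∂μ ≤ ∑ i, p i * (σ i + s i) ^ 2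
        + (∫ x, x ∂μ).ofLp ⬝ᵥ ((W * diagonal p * Wᵀ) *ᵥ (∫ x, x ∂μ).ofLp) := by
  have hL := memLp_of_mem_ambiguitySet hρ href.memLp hμ
  set a := ∫ x, x ∂μ
  set I := ∫ x, x.ofLp ⬝ᵥ ((W * diagonal p * Wᵀ) *ᵥ x.ofLp) ∂μ
  set b := a.ofLp ⬝ᵥ ((W * diagonal p * Wᵀ) *ᵥ a.ofLp)
  have hε : ∀ ε : ℝ, 0 < ε → ∃ s : EuclideanSpace ℝ (Fin d), ‖s‖ ^ 2 + ‖a‖ ^ 2 ≤ ρ ^ 2 + ε ∧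
      I ≤ ∑ i, p i * (σ i + s i) ^ 2 + b := fun ε hε => by
    obtain ⟨γ, hγ, hlt⟩ := exists_coupling_lt hρ hε hμ
    exact exists_bound_of_coupling href hW' hp hσ hσV hL hγ (by positivity) hlt.le
  -- The larger violation of the two required inequalities. Its minimum over the ball of radius `ρ +
  -- 1` is at most every `ε > 0`.
  let h : EuclideanSpace ℝ (Fin d) → ℝ := fun s =>
    max (‖s‖ ^ 2 + ‖a‖ ^ 2 - ρ ^ 2) (I - (∑ i, p i * (σ i + s i) ^ 2 + b))
  have hc : Continuous h := by fun_prop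
  obtain ⟨s, -, hs⟩ := (isCompact_closedBall (0 : EuclideanSpace ℝ (Fin d)) (ρ + 1)).exists_isMinOn
    ⟨0, by simp; linarith⟩ hc.continuousOn
  have hle : h s ≤ 0 := by
    refine le_of_forall_pos_le_add fun ε hε0 => ?_
    rw [zero_add]
    -- Capping the slack at `1` keeps `y` in the ball, because `ρ² + 1 ≤ (ρ + 1)²`.
    obtain ⟨y, hy1, hy2⟩ := hε (min ε 1) (by positivity)
    have hyb : y ∈ Metric.closedBall (0 : EuclideanSpace ℝ (Fin d)) (ρ + 1) := by
      rw [mem_closedBall_zero_iff]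
      refine le_of_sq_le_sq ?_ (by linarith)
      nlinarith [sq_nonneg ‖a‖, min_le_right ε 1]
    refine (hs hyb).trans (max_le ?_ ?_)
    · linarith [min_le_left ε 1]
    · linarith
  exact ⟨s, by linarith [(le_max_left _ _).trans hle], by linarith [(le_max_right _ _).trans hle]⟩

/-- The graph coupling `(M x + c, x)` has as its cost the second moment of `(M - 1) x + c`, which is
the left side of the hypothesis. -/
theorem map_affineMap_mem_ambiguitySet [IsProbabilityMeasure μref] (href : HasMeanCov μref 0 V)
    {ρ : ℝ} (hρ : 0 ≤ ρ) (M : Matrix (Fin d) (Fin d) ℝ) (c : EuclideanSpace ℝ (Fin d))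
    (h : (V * ((M - 1)ᵀ * (M - 1))).trace + ‖c‖ ^ 2 ≤ ρ ^ 2) :
    μref.map (affineMap M c) ∈ ambiguitySet ρ μref := by
  have hA := (continuous_affineMap M c).measurable
  refine ⟨Measure.isProbabilityMeasure_map hA.aemeasurable, ?_⟩
  set γ := μref.map fun x => (affineMap M c x, x) with hγdef
  have hpair : Measurable fun x : EuclideanSpace ℝ (Fin d) => (affineMap M c x, x) :=
    hA.prodMk measurable_id
  have hγ : γ ∈ couplings (μref.map (affineMap M c)) μref := by
    refine ⟨Measure.isProbabilityMeasure_map hpair.aemeasurable, ?_, ?_⟩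
    · rw [hγdef, Measure.map_map measurable_fst hpair]
      rfl
    · rw [hγdef, Measure.map_map measurable_snd hpair]
      exact Measure.map_id
  have hdiff : ∀ x, affineMap M c x - x = affineMap (M - 1) c x := fun x => by
    ext i
    simp [affineMap, sub_mulVec]
    ring
  have hN := href.map_affineMap (M - 1) c
  have hA' := (continuous_affineMap (M - 1) c).measurable
  have hprob : IsProbabilityMeasure (μref.map (affineMap (M - 1) c)) :=
    Measure.isProbabilityMeasure_map hA'.aemeasurable
  have hval : ∫⁻ z, ‖z.1 - z.2‖ₑ ^ 2 ∂γ ≤ ENNReal.ofReal (ρ ^ 2) := by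
    rw [hγdef, lintegral_map (by fun_prop) hpair]
    simp only [hdiff]
    rw [← lintegral_map (f := fun y => ‖y‖ₑ ^ 2) (by fun_prop) hA',
      lintegral_enorm_sq_eq (X := fun y => y) hN.memLp]
    refine ENNReal.ofReal_le_ofReal (le_trans (le_of_eq ?_) h)
    have h1 := hN.integral_quadratic 1
    simp only [one_mulVec, transpose_one, Matrix.mul_one] at h1
    have h2 : ∀ x : EuclideanSpace ℝ (Fin d), ‖x‖ ^ 2 = x.ofLp ⬝ᵥ x.ofLp := fun x => by
      rw [EuclideanSpace.real_norm_sq_eq, dotProduct]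
      exact Finset.sum_congr rfl fun i _ => sq _
    simp only [h2]
    rw [h1, Matrix.mul_assoc, Matrix.trace_mul_comm, Matrix.mul_assoc]
  rw [wasserstein2]
  calc _ ≤ (ENNReal.ofReal (ρ ^ 2)) ^ (1 / 2 : ℝ) :=
        ENNReal.rpow_le_rpow ((iInf₂_le γ hγ).trans hval) (by norm_num)
    _ = ENNReal.ofReal ρ := by
        rw [ENNReal.ofReal_pow hρ, ← ENNReal.rpow_natCast, ← ENNReal.rpow_mul]
        norm_num

end Wasserstein

/-! ### The two-player quadratic problem over balls -/

section Side

variable {d d' : ℕ}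

/-- The part of the objective that depends on one of the two noise laws only. -/
noncomputable def sideObjective (p σ : Fin d → ℝ) (A : Matrix (Fin d) (Fin d) ℝ) (c : Fin d → ℝ)
    (s m : EuclideanSpace ℝ (Fin d)) : ℝ :=
  ∑ i, p i * (σ i + s i) ^ 2 + m.ofLp ⬝ᵥ (A *ᵥ m.ofLp) + c ⬝ᵥ m.ofLp

theorem continuous_sideObjective (p σ : Fin d → ℝ) (A : Matrix (Fin d) (Fin d) ℝ)
    (c : Fin d → ℝ) : Continuous fun z : EuclideanSpace ℝ (Fin d) × EuclideanSpace ℝ (Fin d) =>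
      sideObjective p σ A c z.1 z.2 := by
  simp only [sideObjective, dotProduct, mulVec]
  fun_prop

theorem isCompact_pairBall (d : ℕ) (ρ : ℝ) :
    IsCompact {z : EuclideanSpace ℝ (Fin d) × EuclideanSpace ℝ (Fin d) |
      ‖z.1‖ ^ 2 + ‖z.2‖ ^ 2 ≤ ρ ^ 2} := by
  refine Metric.isCompact_of_isClosed_isBounded ?_ ?_
  · exact isClosed_le (by fun_prop) continuous_const
  · refine (Metric.isBounded_closedBall (x := 0) (r := |ρ|)).subset fun z hz => ?_
    rw [mem_closedBall_zero_iff, Prod.norm_def]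
    have hz : ‖z.1‖ ^ 2 + ‖z.2‖ ^ 2 ≤ ρ ^ 2 := hz
    rw [← sq_abs ρ] at hz
    refine max_le ?_ ?_
    · exact le_of_sq_le_sq (by nlinarith [sq_nonneg ‖z.2‖]) (abs_nonneg _)
    · exact le_of_sq_le_sq (by nlinarith [sq_nonneg ‖z.1‖]) (abs_nonneg _)

/-- A maximiser of the two-sided problem exists. -/
theorem exists_isMax_pair (p σ : Fin d → ℝ) (A : Matrix (Fin d) (Fin d) ℝ) (c : Fin d → ℝ)
    (p' σ' : Fin d' → ℝ) (A' : Matrix (Fin d') (Fin d') ℝ) (c' : Fin d' → ℝ)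
    (S : Matrix (Fin d') (Fin d) ℝ) (ρ ρ' : ℝ) :
    ∃ (s m : EuclideanSpace ℝ (Fin d)) (s' m' : EuclideanSpace ℝ (Fin d')),
      ‖s‖ ^ 2 + ‖m‖ ^ 2 ≤ ρ ^ 2 ∧ ‖s'‖ ^ 2 + ‖m'‖ ^ 2 ≤ ρ' ^ 2 ∧
      ∀ (t a : EuclideanSpace ℝ (Fin d)) (t' a' : EuclideanSpace ℝ (Fin d')),
        ‖t‖ ^ 2 + ‖a‖ ^ 2 ≤ ρ ^ 2 → ‖t'‖ ^ 2 + ‖a'‖ ^ 2 ≤ ρ' ^ 2 →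
        sideObjective p σ A c t a + sideObjective p' σ' A' c' t' a'
            + a'.ofLp ⬝ᵥ (S *ᵥ a.ofLp)
          ≤ sideObjective p σ A c s m + sideObjective p' σ' A' c' s' m'
            + m'.ofLp ⬝ᵥ (S *ᵥ m.ofLp) := by
  have h1 : Continuous fun z : (EuclideanSpace ℝ (Fin d) × EuclideanSpace ℝ (Fin d)) ×
      (EuclideanSpace ℝ (Fin d') × EuclideanSpace ℝ (Fin d')) =>
      sideObjective p σ A c z.1.1 z.1.2 := (continuous_sideObjective p σ A c).comp continuous_fst
  have h2 : Continuous fun z : (EuclideanSpace ℝ (Fin d) × EuclideanSpace ℝ (Fin d)) ×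
      (EuclideanSpace ℝ (Fin d') × EuclideanSpace ℝ (Fin d')) =>
      sideObjective p' σ' A' c' z.2.1 z.2.2 :=
    (continuous_sideObjective p' σ' A' c').comp continuous_snd
  have h3 : Continuous fun z : (EuclideanSpace ℝ (Fin d) × EuclideanSpace ℝ (Fin d)) ×
      (EuclideanSpace ℝ (Fin d') × EuclideanSpace ℝ (Fin d')) =>
      z.2.2.ofLp ⬝ᵥ (S *ᵥ z.1.2.ofLp) := by
    simp only [dotProduct, mulVec]
    fun_prop
  obtain ⟨z, hz, hmax⟩ :=
    ((isCompact_pairBall d ρ).prod (isCompact_pairBall d' ρ')).exists_isMaxOn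
      ⟨((0, 0), (0, 0)), by simp [sq_nonneg]⟩ ((h1.add h2).add h3).continuousOn
  refine ⟨z.1.1, z.1.2, z.2.1, z.2.2, hz.1, hz.2, fun t a t' a' h h' => ?_⟩
  exact isMaxOn_iff.1 hmax ((t, a), (t', a')) (Set.mk_mem_prod h h')

/-- Multiplier and stationarity conditions for one of the two sides. -/
theorem exists_multiplier_side {ρ : ℝ} (hρ : 0 < ρ) {p σ : Fin d → ℝ} (hp : ∀ i, 0 ≤ p i)
    (hσ : ∀ i, 0 < σ i) {A : Matrix (Fin d) (Fin d) ℝ} (hA : Aᵀ = A) {c g : Fin d → ℝ}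
    {s m : EuclideanSpace ℝ (Fin d)} (hz : ‖s‖ ^ 2 + ‖m‖ ^ 2 ≤ ρ ^ 2)
    (hmax : ∀ t a : EuclideanSpace ℝ (Fin d), ‖t‖ ^ 2 + ‖a‖ ^ 2 ≤ ρ ^ 2 →
      sideObjective p σ A c t a + g ⬝ᵥ a.ofLp ≤ sideObjective p σ A c s m + g ⬝ᵥ m.ofLp)
    (hzero : (∀ i, p i = 0) → A = 0 ∧ c = 0 ∧ g = 0 ∧ s = 0 ∧ ‖m‖ = ρ) :
    ∃ r : ℝ, ((∀ i, p i = 0) → r = 0) ∧ ((∃ i, 0 < p i) → ∀ i, p i < r) ∧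
      (∀ i, r * s i = p i * (σ i + s i)) ∧ ‖s‖ ^ 2 + ‖m‖ ^ 2 = ρ ^ 2 ∧
      r • m.ofLp - A *ᵥ m.ofLp - (1 / 2 : ℝ) • g = (1 / 2 : ℝ) • c := by
  by_cases hp0 : ∀ i, p i = 0
  -- Here the objective is constant, so optimality says nothing; the radius equation holds because
  -- `m` was chosen on the sphere.
  · obtain ⟨rfl, rfl, rfl, rfl, hm⟩ := hzero hp0
    refine ⟨0, fun _ => rfl, fun ⟨i, hi⟩ => absurd (hp0 i) hi.ne', fun i => ?_, ?_, ?_⟩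
    · simp [hp0 i]
    · simp [hm]
    · simp
  have hex : ∃ i, 0 < p i := by
    push Not at hp0
    obtain ⟨i, hi⟩ := hp0
    exact ⟨i, lt_of_le_of_ne (hp i) hi.symm⟩
  -- The gradient at `m` of the part that depends on the mean; `g` is the cross term with the mean
  -- of the other side frozen.
  let l : EuclideanSpace ℝ (Fin d) →ₗ[ℝ] ℝ :=
    { toFun := fun e => ((2 : ℝ) • (A *ᵥ m.ofLp) + c + g) ⬝ᵥ e.ofLp
      map_add' := fun x y => by simp [dotProduct_add]
      map_smul' := fun r x => by simp [dotProduct_smul] }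
  obtain ⟨r, hr1, hr2, hr3, hr4⟩ := exists_multiplier_gt hρ hp hσ hex
    (ψ := fun a => a.ofLp ⬝ᵥ (A *ᵥ a.ofLp) + c ⬝ᵥ a.ofLp + g ⬝ᵥ a.ofLp) hz
    (fun t a h => by
      have := hmax t a h
      simp only [sideObjective] at this
      linarith) l (fun e => e.ofLp ⬝ᵥ (A *ᵥ e.ofLp))
    (fun t e => by
      simp only [WithLp.ofLp_smul, mulVec_smul, dotProduct_smul, smul_dotProduct, smul_eq_mul]
      ring)
    (fun e => by
      have hs : m.ofLp ⬝ᵥ (A *ᵥ e.ofLp) = (A *ᵥ m.ofLp) ⬝ᵥ e.ofLp := by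
        rw [dotProduct_mulVec, ← mulVec_transpose, hA]
      change _ = _ + ((2 : ℝ) • (A *ᵥ m.ofLp) + c + g) ⬝ᵥ e.ofLp + _
      simp only [WithLp.ofLp_add, mulVec_add, dotProduct_add, add_dotProduct, smul_dotProduct,
        hs, dotProduct_comm e.ofLp (A *ᵥ m.ofLp), smul_eq_mul]
      ring)
  refine ⟨r, fun h => absurd h hp0, fun _ => hr1, hr2, hr3, ?_⟩
  funext i
  have h := hr4 (EuclideanSpace.single i 1)
  have h' : 2 * (A *ᵥ m.ofLp) i + c i + g i = 2 * r * m i := by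
    simpa [l, EuclideanSpace.inner_single_right] using h
  simp only [Pi.sub_apply, Pi.smul_apply, smul_eq_mul]
  linarith

end Side

/-! ### The worst-case law on one side -/

section WorstCase

variable {d : ℕ} {μref : Measure (EuclideanSpace ℝ (Fin d))} {V : Matrix (Fin d) (Fin d) ℝ}
  {W : Matrix (Fin d) (Fin d) ℝ} {p σ : Fin d → ℝ} {r : ℝ}

/-- The resolvent expressions of the worst-case law in the eigenbasis. -/
theorem resolvent_eq (hW : Wᵀ * W = 1) (hW' : W * Wᵀ = 1) (hp : ∀ i, 0 ≤ p i)
    (hσ : ∀ i, 0 < σ i) {s : Fin d → ℝ} (hs0 : (∀ i, p i = 0) → s = 0 ∧ r = 0)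
    (hr : (∃ i, 0 < p i) → ∀ i, p i < r) (hs : ∀ i, r * s i = p i * (σ i + s i)) :
    (1 - r⁻¹ • (W * diagonal p * Wᵀ))⁻¹ = W * diagonal (fun i => 1 + s i / σ i) * Wᵀ ∧
    (W * diagonal p * Wᵀ) * (r • (1 : Matrix (Fin d) (Fin d) ℝ) - W * diagonal p * Wᵀ)⁻¹
      = W * diagonal (fun i => s i / σ i) * Wᵀ ∧
    (W * diagonal p * Wᵀ) ^ 2 * ((r • (1 : Matrix (Fin d) (Fin d) ℝ) - W * diagonal p * Wᵀ)⁻¹) ^ 2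
      = W * diagonal (fun i => (s i / σ i) ^ 2) * Wᵀ := by
  by_cases hp0 : ∀ i, p i = 0
  -- With `P = 0` and `r = 0` the push matrix is the identity, and the other two expressions contain
  -- the factor `P`, so the value of the singular inverse is irrelevant.
  · obtain ⟨rfl, rfl⟩ := hs0 hp0
    have hpz : p = fun _ => 0 := funext hp0
    have hz : W * diagonal (fun _ => (0 : ℝ)) * Wᵀ = 0 := by simp
    subst hpz
    simp only [hz, Pi.zero_apply, zero_div, add_zero, conj_diagonal_const hW']
    simp
  · have hex : ∃ i, 0 < p i := by
      push Not at hp0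
      obtain ⟨i, hi⟩ := hp0
      exact ⟨i, lt_of_le_of_ne (hp i) hi.symm⟩
    have hlt := hr hex
    have hrpos : 0 < r := by
      obtain ⟨i, hi⟩ := hex
      exact hi.trans (hlt i)
    have hne : ∀ i, r - p i ≠ 0 := fun i => (sub_pos.2 (hlt i)).ne'
    have hne' : ∀ i, 1 - r⁻¹ * p i ≠ 0 := fun i => by
      have : 1 - r⁻¹ * p i = r⁻¹ * (r - p i) := by field_simp
      rw [this]
      exact mul_ne_zero (inv_ne_zero hrpos.ne') (hne i)
    -- Stationarity solved for `s`. Consequently `1 + sᵢ / σᵢ = r / (r - pᵢ)`, an eigenvalue of `(1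
    -- - r⁻¹ P)⁻¹`.
    have hsσ : ∀ i, s i / σ i = p i * (r - p i)⁻¹ := fun i => by
      have h1 := hs i
      have h2 := (hσ i).ne'
      have h3 := hne i
      field_simp
      linarith
    have e1 : r • (1 : Matrix (Fin d) (Fin d) ℝ) - W * diagonal p * Wᵀ
        = W * diagonal (fun i => r - p i) * Wᵀ := by
      rw [← conj_diagonal_const hW' r, conj_diagonal_sub]
    have e2 : 1 - r⁻¹ • (W * diagonal p * Wᵀ) = W * diagonal (fun i => 1 - r⁻¹ * p i) * Wᵀ := by
      rw [conj_diagonal_smul, ← conj_diagonal_sub, conj_diagonal_const hW', one_smul]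
    rw [e1, e2, conj_diagonal_inv hW hW' hne, conj_diagonal_inv hW hW' hne', sq, sq]
    simp only [conj_diagonal_mul hW, hsσ]
    refine ⟨?_, trivial, ?_⟩
    · congr 3
      funext i
      have h3 := hne i
      have h4 := hne' i
      have h5 : 1 - r⁻¹ * p i = (r - p i) / r := by field_simp
      rw [h5]
      field_simp
      ring
    · congr 3
      funext i
      ring

end WorstCase

/-! ### Semidefiniteness and the degenerate cases -/

namespace LQSystem

variable {n m p T : ℕ} (S : LQSystem n m p T)

theorem stackedQ_posSemidef (hQ : ∀ t, (S.Q t).PosSemidef) : S.stackedQ.PosSemidef := by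
  refine PosSemidef.of_dotProduct_mulVec_nonneg ?_ fun x => ?_
  · rw [IsHermitian, conjTranspose_eq_transpose_of_trivial]
    exact S.stackedQ_transpose fun t => (hQ t).isHermitian
  · rw [star_trivial, dotProduct_stackedQ]
    exact Finset.sum_nonneg fun t _ => by
      simpa using (hQ t).dotProduct_mulVec_nonneg fun i => x (t, i)

theorem stackedR_posSemidef (hR : ∀ t, (S.R t).PosSemidef) : S.stackedR.PosSemidef := by
  refine PosSemidef.of_dotProduct_mulVec_nonneg ?_ fun x => ?_
  · rw [IsHermitian, conjTranspose_eq_transpose_of_trivial]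
    exact S.stackedR_transpose fun t => (hR t).isHermitian
  · rw [star_trivial, dotProduct_stackedR]
    exact Finset.sum_nonneg fun t _ => by
      simpa using (hR t).dotProduct_mulVec_nonneg fun i => x (t, i)

end LQSystem

theorem Matrix.PosSemidef.transpose_mul_mul_self {α β : Type*} [Fintype α] [Fintype β]
    {Q : Matrix α α ℝ} (hQ : Q.PosSemidef) (M : Matrix α β ℝ) : (Mᵀ * Q * M).PosSemidef := by
  have := hQ.conjTranspose_mul_mul_same M
  rwa [conjTranspose_eq_transpose_of_trivial] at this

/-- Each column of `M` is isotropic for a semidefinite form, hence lies in the kernel of `Q`. -/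
theorem Matrix.PosSemidef.mul_eq_zero_of_transpose_mul_mul_self {α β : Type*} [Fintype α]
    [Fintype β] {Q : Matrix α α ℝ} (hQ : Q.PosSemidef) {M : Matrix α β ℝ}
    (h : Mᵀ * Q * M = 0) : Q * M = 0 := by
  ext i j
  have h1 : star (fun k => M k j) ⬝ᵥ (Q *ᵥ fun k => M k j) = 0 := by
    have := congrFun (congrFun h j) j
    rw [Matrix.mul_assoc, Matrix.mul_apply] at this
    exact this
  exact congrFun ((hQ.dotProduct_mulVec_zero_iff _).1 h1) i

theorem LQSystem.block_sum_posSemidef {a T : ℕ} {F : Matrix (Fin T × Fin a) (Fin T × Fin a) ℝ}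
    (hF : F.PosSemidef) : (∑ t, LQSystem.block F t t).PosSemidef :=
  Matrix.posSemidef_sum _ fun _ _ => hF.submatrix _

/-- The sum of the diagonal blocks has the same trace as `F`, and a semidefinite matrix of trace
zero vanishes. -/
theorem LQSystem.eq_zero_of_block_sum_eq_zero {a T : ℕ}
    {F : Matrix (Fin T × Fin a) (Fin T × Fin a) ℝ} (hF : F.PosSemidef)
    (h : ∑ t, LQSystem.block F t t = 0) : F = 0 := by
  rw [← hF.trace_eq_zero_iff]
  have : F.trace = (∑ t, LQSystem.block F t t).trace := by
    rw [Matrix.trace_sum]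
    simp only [Matrix.trace, Matrix.diag, Fintype.sum_prod_type, LQSystem.block,
      Matrix.submatrix_apply]
  rw [this, h, Matrix.trace_zero]

namespace LQSystem

variable {n m p T : ℕ} (S : LQSystem n m p T)

/-- The congruence form, from which semidefiniteness and the vanishing of the separate summands are
read off. -/
theorem F₁_eq (π : LinearPolicy m p T) :
    S.F₁ π = (S.U π * S.stackedD)ᵀ * S.stackedR * (S.U π * S.stackedD)
      + (S.stackedH * S.U π * S.stackedD + S.stackedG)ᵀ * S.stackedQ *
        (S.stackedH * S.U π * S.stackedD + S.stackedG) := by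
  simp only [F₁, Matrix.transpose_mul, Matrix.mul_assoc]

theorem F₂_eq (π : LinearPolicy m p T) :
    S.F₂ π = (S.U π)ᵀ * S.stackedR * S.U π
      + (S.stackedH * S.U π)ᵀ * S.stackedQ * (S.stackedH * S.U π) := by
  simp only [F₂, Matrix.transpose_mul, Matrix.mul_assoc]

theorem F₁_posSemidef (hQ : ∀ t, (S.Q t).PosSemidef) (hR : ∀ t, (S.R t).PosSemidef)
    (π : LinearPolicy m p T) : (S.F₁ π).PosSemidef := by
  rw [F₁_eq]
  exact ((S.stackedR_posSemidef hR).transpose_mul_mul_self _).add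
    ((S.stackedQ_posSemidef hQ).transpose_mul_mul_self _)

theorem F₂_posSemidef (hQ : ∀ t, (S.Q t).PosSemidef) (hR : ∀ t, (S.R t).PosSemidef)
    (π : LinearPolicy m p T) : (S.F₂ π).PosSemidef := by
  rw [F₂_eq]
  exact ((S.stackedR_posSemidef hR).transpose_mul_mul_self _).add
    ((S.stackedQ_posSemidef hQ).transpose_mul_mul_self _)

end LQSystem

theorem Matrix.PosSemidef.eq_zero_of_add_eq_zero {α : Type*} [Fintype α] {A B : Matrix α α ℝ}
    (hA : A.PosSemidef) (hB : B.PosSemidef) (h : A + B = 0) : A = 0 ∧ B = 0 := by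
  have ht : A.trace + B.trace = 0 := by rw [← Matrix.trace_add, h, Matrix.trace_zero]
  have h1 := hA.trace_nonneg
  have h2 := hB.trace_nonneg
  exact ⟨hA.trace_eq_zero_iff.1 (by linarith), hB.trace_eq_zero_iff.1 (by linarith)⟩

namespace LQSystem

variable {n m p T : ℕ} (S : LQSystem n m p T)

/-- If `P_v = 0`, the cost does not depend on the process noise. -/
theorem eq_zero_of_Pv_eq_zero (hQ : ∀ t, (S.Q t).PosSemidef) (hR : ∀ t, (S.R t).PosSemidef)
    (x₀ : Fin n → ℝ) (π : LinearPolicy m p T) (h : S.Pv π = 0) :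
    S.Nv π = 0 ∧ S.Smat π = 0 ∧ S.nv π x₀ = 0 := by
  have hF : S.F₁ π = 0 := eq_zero_of_block_sum_eq_zero (S.F₁_posSemidef hQ hR π) h
  have hsum := hF
  rw [F₁_eq] at hsum
  obtain ⟨hA, hB⟩ := ((S.stackedR_posSemidef hR).transpose_mul_mul_self _).eq_zero_of_add_eq_zero
    ((S.stackedQ_posSemidef hQ).transpose_mul_mul_self _) hsum
  -- `R U D = 0` and `Q (H U D + G) = 0`: every term of `F₃` and `f₁`, suitably grouped, contains
  -- one of these factors.
  have hRU := (S.stackedR_posSemidef hR).mul_eq_zero_of_transpose_mul_mul_self hA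
  have hQM := (S.stackedQ_posSemidef hQ).mul_eq_zero_of_transpose_mul_mul_self hB
  have hF3 : S.F₃ π = 0 := by
    have e1 : (S.U π)ᵀ * S.stackedR * S.U π * S.stackedD = 0 := by
      rw [Matrix.mul_assoc, Matrix.mul_assoc, hRU, Matrix.mul_zero]
    have e2 : (S.U π)ᵀ * S.stackedHᵀ * S.stackedQ *
        (S.stackedH * S.U π * S.stackedD + S.stackedG) = 0 := by
      rw [Matrix.mul_assoc, hQM, Matrix.mul_zero]
    rw [F₃, e1, e2, smul_zero, add_zero]
  have hf1 : S.f₁ π x₀ = 0 := by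
    have e1 : S.stackedR * S.U π * S.stackedD + S.stackedHᵀ * S.stackedQ * S.stackedG
        + S.stackedHᵀ * S.stackedQ * S.stackedH * S.U π * S.stackedD = 0 := by
      have : S.stackedR * S.U π * S.stackedD + S.stackedHᵀ * S.stackedQ * S.stackedG
        + S.stackedHᵀ * S.stackedQ * S.stackedH * S.U π * S.stackedD
        = S.stackedR * (S.U π * S.stackedD) + S.stackedHᵀ * (S.stackedQ *
          (S.stackedH * S.U π * S.stackedD + S.stackedG)) := by
        simp only [Matrix.mul_add, Matrix.mul_assoc]
        abel
      rw [this, hRU, hQM, Matrix.mul_zero, add_zero]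
    have e2 : S.stackedLᵀ * S.stackedQ *
        (S.stackedH * S.U π * S.stackedD + S.stackedG) = 0 := by
      rw [Matrix.mul_assoc, hQM, Matrix.mul_zero]
    rw [f₁, e1, e2]
    simp
  refine ⟨?_, ?_, ?_⟩
  · simp [Nv, hF, block]
  · simp [Smat, hF3, block]
  · funext i
    simp [nv, hf1]

/-- If `P_w = 0`, the cost does not depend on the measurement noise. -/
theorem eq_zero_of_Pw_eq_zero (hQ : ∀ t, (S.Q t).PosSemidef) (hR : ∀ t, (S.R t).PosSemidef)
    (x₀ : Fin n → ℝ) (π : LinearPolicy m p T) (h : S.Pw π = 0) :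
    S.Nw π = 0 ∧ S.Smat π = 0 ∧ S.nw π x₀ = 0 := by
  have hF : S.F₂ π = 0 := eq_zero_of_block_sum_eq_zero (S.F₂_posSemidef hQ hR π) h
  have hsum := hF
  rw [F₂_eq] at hsum
  obtain ⟨hA, hB⟩ := ((S.stackedR_posSemidef hR).transpose_mul_mul_self _).eq_zero_of_add_eq_zero
    ((S.stackedQ_posSemidef hQ).transpose_mul_mul_self _) hsum
  have hRU := (S.stackedR_posSemidef hR).mul_eq_zero_of_transpose_mul_mul_self hA
  have hQM := (S.stackedQ_posSemidef hQ).mul_eq_zero_of_transpose_mul_mul_self hB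
  -- In `F₃` the vanishing factors occur on the left, hence transposed.
  have hRU' : (S.U π)ᵀ * S.stackedR = 0 := by
    rw [← S.stackedR_transpose fun t => (hR t).isHermitian, ← Matrix.transpose_mul, hRU,
      Matrix.transpose_zero]
  have hQM' : (S.U π)ᵀ * S.stackedHᵀ * S.stackedQ = 0 := by
    rw [← S.stackedQ_transpose fun t => (hQ t).isHermitian, ← Matrix.transpose_mul,
      ← Matrix.transpose_mul, hQM, Matrix.transpose_zero]
  have hF3 : S.F₃ π = 0 := by
    rw [F₃, hRU', hQM']
    simp
  have hf2 : S.f₂ π x₀ = 0 := by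
    have e1 : (S.stackedR + S.stackedHᵀ * S.stackedQ * S.stackedH) * S.U π = 0 := by
      rw [Matrix.add_mul, hRU, Matrix.mul_assoc, Matrix.mul_assoc, hQM, Matrix.mul_zero, add_zero]
    have e2 : S.stackedLᵀ * S.stackedQ * S.stackedH * S.U π = 0 := by
      rw [Matrix.mul_assoc, Matrix.mul_assoc, hQM, Matrix.mul_zero]
    rw [f₂, e1, e2]
    simp
  refine ⟨?_, ?_, ?_⟩
  · simp [Nw, hF, block]
  · simp [Smat, hF3, block]
  · funext i
    simp [nw, hf2]

theorem Nv_transpose (π : LinearPolicy m p T) : (S.Nv π)ᵀ = S.Nv π := by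
  simp only [Nv, Matrix.transpose_sum, Matrix.transpose_add, Matrix.transpose_transpose]
  simp only [add_comm]

theorem Nw_transpose (π : LinearPolicy m p T) : (S.Nw π)ᵀ = S.Nw π := by
  simp only [Nw, Matrix.transpose_sum, Matrix.transpose_add, Matrix.transpose_transpose]
  simp only [add_comm]

end LQSystem

/-! ### Feasibility and moments of the worst-case law -/

section WorstCase

variable {d : ℕ} {μref : Measure (EuclideanSpace ℝ (Fin d))} [IsProbabilityMeasure μref]
  {V W : Matrix (Fin d) (Fin d) ℝ} {p σ : Fin d → ℝ} {r ρ : ℝ}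

/-- Feasibility, moments and radius equation of the worst-case law on one side. -/
theorem worstCase_side (href : HasMeanCov μref 0 V) (hρ : 0 ≤ ρ) (hW : Wᵀ * W = 1)
    (hW' : W * Wᵀ = 1) (hp : ∀ i, 0 ≤ p i) (hσ : ∀ i, 0 < σ i)
    (hσV : ∀ i, σ i ^ 2 = (Wᵀ * V * W) i i) {P : Matrix (Fin d) (Fin d) ℝ}
    (hP : P = W * diagonal p * Wᵀ) {s m : EuclideanSpace ℝ (Fin d)}
    (hs0 : (∀ i, p i = 0) → s = 0 ∧ r = 0) (hr : (∃ i, 0 < p i) → ∀ i, p i < r)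
    (hs : ∀ i, r * s i = p i * (σ i + s i)) (hnorm : ‖s‖ ^ 2 + ‖m‖ ^ 2 = ρ ^ 2) :
    (V * P ^ 2 * ((r • (1 : Matrix (Fin d) (Fin d) ℝ) - P)⁻¹) ^ 2).trace + ‖m‖ ^ 2 = ρ ^ 2 ∧
    ∑ i, p i * (σ i + s i) ^ 2
      = r * ‖s‖ ^ 2 + r * (V * P * (r • (1 : Matrix (Fin d) (Fin d) ℝ) - P)⁻¹).trace ∧
    μref.map (affinePush P r m) ∈ ambiguitySet ρ μref ∧
    HasMeanCov (μref.map (affinePush P r m)) m ((1 - r⁻¹ • P)⁻¹ * V * (1 - r⁻¹ • P)⁻¹) ∧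
    ∫ x, x.ofLp ⬝ᵥ (P *ᵥ x.ofLp) ∂(μref.map (affinePush P r m))
      = ∑ i, p i * (σ i + s i) ^ 2 + m.ofLp ⬝ᵥ (P *ᵥ m.ofLp) := by
  obtain ⟨h1, h2, h3⟩ := resolvent_eq (s := s.ofLp) hW hW' hp hσ
    (fun h => ⟨by rw [(hs0 h).1]; rfl, (hs0 h).2⟩) hr hs
  rw [← hP] at h1 h2 h3
  have hpush : affinePush P r m = affineMap (1 - r⁻¹ • P)⁻¹ m := rfl
  set M := (1 - r⁻¹ • P)⁻¹ with hM
  have hMt : Mᵀ = M := by rw [h1, conj_diagonal_transpose]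
  have hM1 : M - 1 = W * diagonal (fun i => s i / σ i) * Wᵀ := by
    have : (1 : Matrix (Fin d) (Fin d) ℝ) = W * diagonal (fun _ => 1) * Wᵀ := by
      rw [conj_diagonal_const hW', one_smul]
    rw [h1, this, conj_diagonal_sub]
    simp
  have hss : ∑ i, (Wᵀ * V * W) i i * (s i / σ i) ^ 2 = ‖s‖ ^ 2 := by
    rw [EuclideanSpace.real_norm_sq_eq]
    refine Finset.sum_congr rfl fun i _ => ?_
    have := (hσ i).ne'
    rw [← hσV]
    field_simp
  have hcov : HasMeanCov (μref.map (affinePush P r m)) m (M * V * M) := by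
    have := href.map_affineMap M m
    rwa [hMt, ← hpush] at this
  refine ⟨?_, ?_, ?_, hcov, ?_⟩
  · rw [Matrix.mul_assoc, h3, trace_mul_conj_diagonal, hss, hnorm]
  · rw [Matrix.mul_assoc, h2, trace_mul_conj_diagonal, EuclideanSpace.real_norm_sq_eq,
      Finset.mul_sum, Finset.mul_sum, ← Finset.sum_add_distrib]
    refine Finset.sum_congr rfl fun i _ => ?_
    have h4 := (hσ i).ne'
    have h5 : (Wᵀ * V * W) i i * (s i / σ i) = σ i * s i := by
      rw [← hσV]
      field_simp
    rw [h5]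
    -- Multiplying stationarity by `σᵢ + sᵢ` gives `pᵢ (σᵢ + sᵢ)² = r sᵢ² + r σᵢ sᵢ`.
    have h6 := hs i
    linear_combination (-(σ i + s i)) * h6
  -- `M - 1` has eigenvalues `sᵢ / σᵢ`, so the graph coupling costs exactly `‖s‖² + ‖m‖² = ρ²`.
  · rw [hpush]
    refine map_affineMap_mem_ambiguitySet href hρ M m (le_of_eq ?_)
    rw [hM1, conj_diagonal_transpose, conj_diagonal_mul hW, trace_mul_conj_diagonal, ← hnorm, ← hss]
    simp only [sq]
  · have hprob : IsProbabilityMeasure (μref.map (affinePush P r m)) := by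
      rw [hpush]
      exact Measure.isProbabilityMeasure_map
        (continuous_affineMap M m).measurable.aemeasurable
    rw [hcov.integral_quadratic]
    congr 1
    have e : (M * V * M * Pᵀ).trace = (V * (M * (Pᵀ * M))).trace := by
      rw [Matrix.mul_assoc, Matrix.mul_assoc, Matrix.trace_mul_comm]
      simp only [Matrix.mul_assoc]
    rw [e, h1, hP, conj_diagonal_transpose, conj_diagonal_mul hW, conj_diagonal_mul hW,
      trace_mul_conj_diagonal]
    refine Finset.sum_congr rfl fun i _ => ?_
    have h4 := (hσ i).ne'
    rw [← hσV]
    field_simp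

end WorstCase

/-! ### The worst-case noise laws -/

theorem lemma1 (n m p T : ℕ) (hn : 0 < n) (hp : 0 < p)
    (S : LQSystem n m p T)
    (hQ : ∀ t, (S.Q t).PosSemidef) (hR : ∀ t, (S.R t).PosDef)
    (x₀ : Fin n → ℝ) (π : LinearPolicy m p T)
    (μref : Measure (EuclideanSpace ℝ (Fin n))) (νref : Measure (EuclideanSpace ℝ (Fin p)))
    [IsProbabilityMeasure μref] [IsProbabilityMeasure νref]
    (Vref : Matrix (Fin n) (Fin n) ℝ) (Wref : Matrix (Fin p) (Fin p) ℝ)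
    (hμref : HasMeanCov μref 0 Vref) (hνref : HasMeanCov νref 0 Wref)
    (hVref : Vref.PosDef) (hWref : Wref.PosDef)
    (ρv ρw : ℝ) (hρv : 0 < ρv) (hρw : 0 < ρw) :
    -- the expected cost is a genuine (finite) integral on the whole ambiguity set
    (∀ μ ∈ ambiguitySet ρv μref, ∀ ν ∈ ambiguitySet ρw νref,
      Integrable (fun z => S.trajectoryCost x₀ π.toPolicy z.1 z.2) (LQSystem.noiseLaw T μ ν)) ∧
    ∃ (lv lw : ℝ) (mv : EuclideanSpace ℝ (Fin n)) (mw : EuclideanSpace ℝ (Fin p)),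
      -- the multipliers exceed the largest eigenvalues (and vanish if the matrix is zero)
      (S.Pv π ≠ 0 → ∀ e ∈ spectrum ℝ (S.Pv π), e < lv) ∧ (S.Pv π = 0 → lv = 0) ∧
      (S.Pw π ≠ 0 → ∀ e ∈ spectrum ℝ (S.Pw π), e < lw) ∧ (S.Pw π = 0 → lw = 0) ∧
      -- the two scalar radius equations
      (Vref * S.Pv π ^ 2 * ((lv • (1 : Matrix (Fin n) (Fin n) ℝ) - S.Pv π)⁻¹) ^ 2).trace
        + ‖mv‖ ^ 2 = ρv ^ 2 ∧
      (Wref * S.Pw π ^ 2 * ((lw • (1 : Matrix (Fin p) (Fin p) ℝ) - S.Pw π)⁻¹) ^ 2).trace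
        + ‖mw‖ ^ 2 = ρw ^ 2 ∧
      -- the multilinear equation
      Matrix.fromBlocks (lv • 1 - S.Pv π - S.Nv π) (-((1 / 2 : ℝ) • (S.Smat π)ᵀ))
          (-((1 / 2 : ℝ) • S.Smat π)) (lw • 1 - S.Pw π - S.Nw π) *ᵥ Sum.elim mv.ofLp mw.ofLp
        = (1 / 2 : ℝ) • Sum.elim (S.nv π x₀) (S.nw π x₀) ∧
      -- the pushforwards are feasible and attain the supremum, whose value is explicit
      μref.map (affinePush (S.Pv π) lv mv) ∈ ambiguitySet ρv μref ∧
      νref.map (affinePush (S.Pw π) lw mw) ∈ ambiguitySet ρw νref ∧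
      IsGreatest {c : ℝ | ∃ μ ∈ ambiguitySet ρv μref, ∃ ν ∈ ambiguitySet ρw νref,
          c = S.cost x₀ π.toPolicy μ ν}
        (S.cost x₀ π.toPolicy (μref.map (affinePush (S.Pv π) lv mv))
          (νref.map (affinePush (S.Pw π) lw mw))) ∧
      S.cost x₀ π.toPolicy (μref.map (affinePush (S.Pv π) lv mv))
          (νref.map (affinePush (S.Pw π) lw mw))
        = S.noiseFreeCost π x₀
          + lv * ρv ^ 2
          + lv * (Vref * S.Pv π * (lv • (1 : Matrix (Fin n) (Fin n) ℝ) - S.Pv π)⁻¹).trace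
          + mv.ofLp ⬝ᵥ S.nv π x₀ / 2
          + lw * ρw ^ 2
          + lw * (Wref * S.Pw π * (lw • (1 : Matrix (Fin p) (Fin p) ℝ) - S.Pw π)⁻¹).trace
          + mw.ofLp ⬝ᵥ S.nw π x₀ / 2 ∧
      -- means and covariances of the worst-case distributions
      HasMeanCov (μref.map (affinePush (S.Pv π) lv mv)) mv
        ((1 - lv⁻¹ • S.Pv π)⁻¹ * Vref * (1 - lv⁻¹ • S.Pv π)⁻¹) ∧
      HasMeanCov (νref.map (affinePush (S.Pw π) lw mw)) mw
        ((1 - lw⁻¹ • S.Pw π)⁻¹ * Wref * (1 - lw⁻¹ • S.Pw π)⁻¹) ∧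
      -- Gaussianity is inherited
      (IsGaussian μref → IsGaussian (μref.map (affinePush (S.Pv π) lv mv))) ∧
      (IsGaussian νref → IsGaussian (νref.map (affinePush (S.Pw π) lw mw))) := by
  have hQ' := fun t => (hQ t).isHermitian
  have hR' := fun t => (hR t).isHermitian
  have hRs := fun t => (hR t).posSemidef
  have hLv : ∀ μ ∈ ambiguitySet ρv μref, MemLp id 2 μ := fun μ hμ =>
    memLp_of_mem_ambiguitySet hρv.le hμref.memLp hμ
  have hLw : ∀ ν ∈ ambiguitySet ρw νref, MemLp id 2 ν := fun ν hν =>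
    memLp_of_mem_ambiguitySet hρw.le hνref.memLp hν
  have hcost : ∀ μ ∈ ambiguitySet ρv μref, ∀ ν ∈ ambiguitySet ρw νref,
      Integrable (fun z => S.trajectoryCost x₀ π.toPolicy z.1 z.2) (LQSystem.noiseLaw T μ ν) ∧
      S.cost x₀ π.toPolicy μ ν = S.noiseFreeCost π x₀
        + (∫ x, x.ofLp ⬝ᵥ (S.Pv π *ᵥ x.ofLp) ∂μ
          + (∫ x, x ∂μ).ofLp ⬝ᵥ (S.Nv π *ᵥ (∫ x, x ∂μ).ofLp))
        + (∫ y, y.ofLp ⬝ᵥ (S.Pw π *ᵥ y.ofLp) ∂ν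
          + (∫ y, y ∂ν).ofLp ⬝ᵥ (S.Nw π *ᵥ (∫ y, y ∂ν).ofLp))
        + (∫ y, y ∂ν).ofLp ⬝ᵥ (S.Smat π *ᵥ (∫ x, x ∂μ).ofLp)
        + S.nv π x₀ ⬝ᵥ (∫ x, x ∂μ).ofLp + S.nw π x₀ ⬝ᵥ (∫ y, y ∂ν).ofLp := by
    intro μ hμ ν hν
    have := hμ.1
    have := hν.1
    exact S.integrable_trajectoryCost_and_cost_eq hQ' hR' x₀ π μ ν (hLv μ hμ) (hLw ν hν)
  refine ⟨fun μ hμ ν hν => (hcost μ hμ ν hν).1, ?_⟩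
  have hPv : (S.Pv π).PosSemidef := LQSystem.block_sum_posSemidef (S.F₁_posSemidef hQ hRs π)
  have hPw : (S.Pw π).PosSemidef := LQSystem.block_sum_posSemidef (S.F₂_posSemidef hQ hRs π)
  obtain ⟨W, p₁, hW, hW', hP, hp₁, hspec⟩ := hPv.exists_spectral
  obtain ⟨X, p₂, hX, hX', hP₂, hp₂, hspec₂⟩ := hPw.exists_spectral
  have hVpos := conj_diag_pos hW' hVref
  have hWpos := conj_diag_pos hX' hWref
  -- Standard deviations of the reference laws along the eigenvectors of `P_v` and `P_w`.
  let σ₁ : Fin n → ℝ := fun i => Real.sqrt ((Wᵀ * Vref * W) i i)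
  let σ₂ : Fin p → ℝ := fun i => Real.sqrt ((Xᵀ * Wref * X) i i)
  have hσ₁ : ∀ i, 0 < σ₁ i := fun i => Real.sqrt_pos.2 (hVpos i)
  have hσ₂ : ∀ i, 0 < σ₂ i := fun i => Real.sqrt_pos.2 (hWpos i)
  have hσV : ∀ i, σ₁ i ^ 2 = (Wᵀ * Vref * W) i i := fun i => Real.sq_sqrt (hVpos i).le
  have hσW : ∀ i, σ₂ i ^ 2 = (Xᵀ * Wref * X) i i := fun i => Real.sq_sqrt (hWpos i).le
  have hz₁ : (∀ i, p₁ i = 0) → S.Pv π = 0 := fun h => by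
    rw [hP, show p₁ = fun _ => 0 from funext h]
    simp
  have hz₂ : (∀ i, p₂ i = 0) → S.Pw π = 0 := fun h => by
    rw [hP₂, show p₂ = fun _ => 0 from funext h]
    simp
  have hzc₁ : S.Pv π = 0 → ∀ i, p₁ i = 0 := fun h =>
    eq_zero_of_conj_diagonal_eq_zero hW (hP ▸ h)
  have hzc₂ : S.Pw π = 0 → ∀ i, p₂ i = 0 := fun h =>
    eq_zero_of_conj_diagonal_eq_zero hX (hP₂ ▸ h)
  have hex₁ : S.Pv π ≠ 0 → ∃ i, 0 < p₁ i := fun h => by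
    by_contra hcon
    push Not at hcon
    exact h (hz₁ fun i => le_antisymm (hcon i) (hp₁ i))
  have hex₂ : S.Pw π ≠ 0 → ∃ i, 0 < p₂ i := fun h => by
    by_contra hcon
    push Not at hcon
    exact h (hz₂ fun i => le_antisymm (hcon i) (hp₂ i))
  have hA₁ : (S.Pv π + S.Nv π)ᵀ = S.Pv π + S.Nv π := by
    have := hPv.isHermitian
    rw [IsHermitian, conjTranspose_eq_transpose_of_trivial] at this
    rw [transpose_add, this, S.Nv_transpose]
  have hA₂ : (S.Pw π + S.Nw π)ᵀ = S.Pw π + S.Nw π := by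
    have := hPw.isHermitian
    rw [IsHermitian, conjTranspose_eq_transpose_of_trivial] at this
    rw [transpose_add, this, S.Nw_transpose]
  -- If `P_v = 0` or `P_w = 0`, the objective ignores that side's variables. There the maximiser is
  -- replaced by `s = 0` and a mean on the sphere, as the radius equation demands.
  obtain ⟨s, mv, s', mw, hzv, hzw, hmax, hdv, hdw⟩ :
      ∃ (s m : EuclideanSpace ℝ (Fin n)) (s' m' : EuclideanSpace ℝ (Fin p)),
      ‖s‖ ^ 2 + ‖m‖ ^ 2 ≤ ρv ^ 2 ∧ ‖s'‖ ^ 2 + ‖m'‖ ^ 2 ≤ ρw ^ 2 ∧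
      (∀ (t a : EuclideanSpace ℝ (Fin n)) (t' a' : EuclideanSpace ℝ (Fin p)),
        ‖t‖ ^ 2 + ‖a‖ ^ 2 ≤ ρv ^ 2 → ‖t'‖ ^ 2 + ‖a'‖ ^ 2 ≤ ρw ^ 2 →
        sideObjective p₁ σ₁ (S.Pv π + S.Nv π) (S.nv π x₀) t a
            + sideObjective p₂ σ₂ (S.Pw π + S.Nw π) (S.nw π x₀) t' a'
            + a'.ofLp ⬝ᵥ (S.Smat π *ᵥ a.ofLp)
          ≤ sideObjective p₁ σ₁ (S.Pv π + S.Nv π) (S.nv π x₀) s m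
            + sideObjective p₂ σ₂ (S.Pw π + S.Nw π) (S.nw π x₀) s' m'
            + m'.ofLp ⬝ᵥ (S.Smat π *ᵥ m.ofLp)) ∧
      (S.Pv π = 0 → s = 0 ∧ ‖m‖ = ρv) ∧ (S.Pw π = 0 → s' = 0 ∧ ‖m'‖ = ρw) := by
    obtain ⟨s, m, s', m', hzv, hzw, hmax⟩ := exists_isMax_pair p₁ σ₁ (S.Pv π + S.Nv π)
      (S.nv π x₀) p₂ σ₂ (S.Pw π + S.Nw π) (S.nw π x₀) (S.Smat π) ρv ρw
    have hv1 : ∃ a b : EuclideanSpace ℝ (Fin n), ‖a‖ ^ 2 + ‖b‖ ^ 2 ≤ ρv ^ 2 ∧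
        (S.Pv π = 0 → a = 0 ∧ ‖b‖ = ρv) ∧ (S.Pv π ≠ 0 → a = s ∧ b = m) := by
      by_cases h : S.Pv π = 0
      · have hb : ‖EuclideanSpace.single (⟨0, hn⟩ : Fin n) ρv‖ = ρv := by
          rw [PiLp.norm_single, Real.norm_of_nonneg hρv.le]
        exact ⟨0, EuclideanSpace.single ⟨0, hn⟩ ρv, by simp [hb], fun _ => ⟨rfl, hb⟩,
          fun h' => absurd h h'⟩
      · exact ⟨s, m, hzv, fun h' => absurd h' h, fun _ => ⟨rfl, rfl⟩⟩
    have hw1 : ∃ a b : EuclideanSpace ℝ (Fin p), ‖a‖ ^ 2 + ‖b‖ ^ 2 ≤ ρw ^ 2 ∧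
        (S.Pw π = 0 → a = 0 ∧ ‖b‖ = ρw) ∧ (S.Pw π ≠ 0 → a = s' ∧ b = m') := by
      by_cases h : S.Pw π = 0
      · have hb : ‖EuclideanSpace.single (⟨0, hp⟩ : Fin p) ρw‖ = ρw := by
          rw [PiLp.norm_single, Real.norm_of_nonneg hρw.le]
        exact ⟨0, EuclideanSpace.single ⟨0, hp⟩ ρw, by simp [hb], fun _ => ⟨rfl, hb⟩,
          fun h' => absurd h h'⟩
      · exact ⟨s', m', hzw, fun h' => absurd h' h, fun _ => ⟨rfl, rfl⟩⟩
    obtain ⟨a, b, hab, hab0, hab1⟩ := hv1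
    obtain ⟨a', b', hab', hab0', hab1'⟩ := hw1
    refine ⟨a, b, a', b', hab, hab', fun t c t' c' ht ht' => (hmax t c t' c' ht ht').trans
      (le_of_eq ?_), hab0, hab0'⟩
    have ev : sideObjective p₁ σ₁ (S.Pv π + S.Nv π) (S.nv π x₀) s m
        = sideObjective p₁ σ₁ (S.Pv π + S.Nv π) (S.nv π x₀) a b := by
      by_cases h : S.Pv π = 0
      · obtain ⟨h1, -, h3⟩ := S.eq_zero_of_Pv_eq_zero hQ hRs x₀ π h
        simp [sideObjective, h, h1, h3, hzc₁ h]
      · rw [(hab1 h).1, (hab1 h).2]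
    have ew : sideObjective p₂ σ₂ (S.Pw π + S.Nw π) (S.nw π x₀) s' m'
        = sideObjective p₂ σ₂ (S.Pw π + S.Nw π) (S.nw π x₀) a' b' := by
      by_cases h : S.Pw π = 0
      · obtain ⟨h1, -, h3⟩ := S.eq_zero_of_Pw_eq_zero hQ hRs x₀ π h
        simp [sideObjective, h, h1, h3, hzc₂ h]
      · rw [(hab1' h).1, (hab1' h).2]
    -- `S` vanishes as soon as one of `P_v`, `P_w` does, so replacing a mean never alters the cross
    -- term.
    have es : m'.ofLp ⬝ᵥ (S.Smat π *ᵥ m.ofLp) = b'.ofLp ⬝ᵥ (S.Smat π *ᵥ b.ofLp) := by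
      by_cases h : S.Pv π = 0
      · simp [(S.eq_zero_of_Pv_eq_zero hQ hRs x₀ π h).2.1]
      by_cases h' : S.Pw π = 0
      · simp [(S.eq_zero_of_Pw_eq_zero hQ hRs x₀ π h').2.1]
      rw [(hab1 h).2, (hab1' h').2]
    rw [ev, ew, es]
  have hcross : ∀ a : EuclideanSpace ℝ (Fin n),
      mw.ofLp ⬝ᵥ (S.Smat π *ᵥ a.ofLp) = ((S.Smat π)ᵀ *ᵥ mw.ofLp) ⬝ᵥ a.ofLp := fun a => by
    rw [dotProduct_mulVec, ← mulVec_transpose]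
  -- With the other side held at its optimum the cross term is linear in this mean; its gradient `Sᵀ
  -- m_w` plays the role of `g`.
  obtain ⟨lv, hlv0, hlv, hsv, hnv, heqv⟩ := exists_multiplier_side (g := (S.Smat π)ᵀ *ᵥ mw.ofLp)
    hρv hp₁ hσ₁ hA₁ hzv
    (fun t a h => by
      have := hmax t a s' mw h hzw
      rw [hcross, hcross] at this
      linarith)
    (fun h => by
      have h0 := hz₁ h
      obtain ⟨h1, h2, h3⟩ := S.eq_zero_of_Pv_eq_zero hQ hRs x₀ π h0
      exact ⟨by rw [h0, h1, add_zero], h3, by rw [h2]; simp, hdv h0⟩)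
  obtain ⟨lw, hlw0, hlw, hsw, hnw, heqw⟩ := exists_multiplier_side (g := S.Smat π *ᵥ mv.ofLp)
    hρw hp₂ hσ₂ hA₂ hzw
    (fun t a h => by
      have := hmax s mv t a hzv h
      rw [dotProduct_comm a.ofLp, dotProduct_comm mw.ofLp] at this
      linarith)
    (fun h => by
      have h0 := hz₂ h
      obtain ⟨h1, h2, h3⟩ := S.eq_zero_of_Pw_eq_zero hQ hRs x₀ π h0
      exact ⟨by rw [h0, h1, add_zero], h3, by rw [h2]; simp, hdw h0⟩)
  obtain ⟨rv1, rv2, rv3, rv4, rv5⟩ := worstCase_side hμref hρv.le hW hW' hp₁ hσ₁ hσV hP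
    (fun h => ⟨(hdv (hz₁ h)).1, hlv0 h⟩) hlv hsv hnv
  obtain ⟨rw1, rw2, rw3, rw4, rw5⟩ := worstCase_side hνref hρw.le hX hX' hp₂ hσ₂ hσW hP₂
    (fun h => ⟨(hdw (hz₂ h)).1, hlw0 h⟩) hlw hsw hnw
  -- The pushforwards realise the finite-dimensional maximum exactly.
  have hopt : S.cost x₀ π.toPolicy (μref.map (affinePush (S.Pv π) lv mv))
      (νref.map (affinePush (S.Pw π) lw mw)) = S.noiseFreeCost π x₀
        + (sideObjective p₁ σ₁ (S.Pv π + S.Nv π) (S.nv π x₀) s mv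
            + sideObjective p₂ σ₂ (S.Pw π + S.Nw π) (S.nw π x₀) s' mw
            + mw.ofLp ⬝ᵥ (S.Smat π *ᵥ mv.ofLp)) := by
    rw [(hcost _ rv3 _ rw3).2, rv4.mean_eq, rw4.mean_eq, rv5, rw5]
    simp only [sideObjective, add_mulVec, dotProduct_add]
    ring
  refine ⟨lv, lw, mv, mw, ?_, fun h => hlv0 (hzc₁ h), ?_, fun h => hlw0 (hzc₂ h), rv1, rw1, ?_,
    rv3, rw3, ⟨⟨_, rv3, _, rw3, rfl⟩, ?_⟩, ?_, rv4, rw4, fun h => ?_, fun h => ?_⟩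
  · intro h e he
    obtain ⟨i, rfl⟩ := hspec e he
    exact hlv (hex₁ h) i
  · intro h e he
    obtain ⟨i, rfl⟩ := hspec₂ e he
    exact hlw (hex₂ h) i
  · rw [fromBlocks_mulVec]
    simp only [Sum.elim_comp_inl, Sum.elim_comp_inr, sub_mulVec, neg_mulVec, smul_mulVec,
      one_mulVec]
    funext i
    rcases i with i | i
    · have := congrFun heqv i
      simp only [add_mulVec, Pi.sub_apply, Pi.add_apply, Pi.smul_apply, smul_eq_mul] at this
      simp only [Sum.elim_inl, Pi.sub_apply, Pi.add_apply, Pi.neg_apply, Pi.smul_apply, smul_eq_mul]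
      linarith
    · have := congrFun heqw i
      simp only [add_mulVec, Pi.sub_apply, Pi.add_apply, Pi.smul_apply, smul_eq_mul] at this
      simp only [Sum.elim_inr, Pi.sub_apply, Pi.add_apply, Pi.neg_apply, Pi.smul_apply, smul_eq_mul]
      linarith
  · rintro _ ⟨μ, hμ, ν, hν, rfl⟩
    -- Any feasible pair of laws is dominated by a feasible finite-dimensional point with the same
    -- means.
    obtain ⟨t, ht, htv⟩ := exists_bound_of_mem_ambiguitySet hμref hW' hp₁ (fun i => (hσ₁ i).le)
      hσV hρv.le hμ
    obtain ⟨t', ht', htw⟩ := exists_bound_of_mem_ambiguitySet hνref hX' hp₂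
      (fun i => (hσ₂ i).le) hσW hρw.le hν
    have hm := hmax t _ t' _ ht ht'
    rw [hopt, (hcost μ hμ ν hν).2]
    refine le_trans ?_ (add_le_add_right hm (S.noiseFreeCost π x₀))
    rw [← hP] at htv
    rw [← hP₂] at htw
    simp only [sideObjective, add_mulVec, dotProduct_add]
    linarith
  · rw [hopt]
    -- Stationarity paired with `m_v`. Together with `e2` it cancels the cross term, halves the
    -- linear terms, and completes `λ ‖s‖²` to `λ ρ²`.
    have e1 : mv.ofLp ⬝ᵥ ((S.Pv π + S.Nv π) *ᵥ mv.ofLp) = lv * ‖mv‖ ^ 2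
        - (1 / 2) * (mw.ofLp ⬝ᵥ (S.Smat π *ᵥ mv.ofLp)) - (1 / 2) * (mv.ofLp ⬝ᵥ S.nv π x₀) := by
      have h := congrArg (fun y => mv.ofLp ⬝ᵥ y) heqv
      simp only [dotProduct_sub, dotProduct_smul, smul_eq_mul] at h
      rw [dotProduct_comm mv.ofLp ((S.Smat π)ᵀ *ᵥ mw.ofLp), ← hcross] at h
      have h2 : mv.ofLp ⬝ᵥ mv.ofLp = ‖mv‖ ^ 2 := by
        rw [EuclideanSpace.real_norm_sq_eq, dotProduct]
        exact Finset.sum_congr rfl fun i _ => (sq _).symm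
      rw [h2] at h
      linarith
    have e2 : mw.ofLp ⬝ᵥ ((S.Pw π + S.Nw π) *ᵥ mw.ofLp) = lw * ‖mw‖ ^ 2
        - (1 / 2) * (mw.ofLp ⬝ᵥ (S.Smat π *ᵥ mv.ofLp)) - (1 / 2) * (mw.ofLp ⬝ᵥ S.nw π x₀) := by
      have h := congrArg (fun y => mw.ofLp ⬝ᵥ y) heqw
      simp only [dotProduct_sub, dotProduct_smul, smul_eq_mul] at h
      have h2 : mw.ofLp ⬝ᵥ mw.ofLp = ‖mw‖ ^ 2 := by
        rw [EuclideanSpace.real_norm_sq_eq, dotProduct]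
        exact Finset.sum_congr rfl fun i _ => (sq _).symm
      rw [h2] at h
      linarith
    simp only [sideObjective]
    rw [rv2, rw2, e1, e2, ← hnv, ← hnw, dotProduct_comm (S.nv π x₀), dotProduct_comm (S.nw π x₀)]
    ring
  · exact isGaussian_map_affineMap _ mv
  · exact isGaussian_map_affineMap _ mw
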